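/- **Theorem 4.2.** For a Gaussian prime $\pi$ of odd norm $N\pi$ and $\alpha\in\mathbb Z[i]$ let $\left(\frac{\alpha}{\pi}\right)_4=0$ if $\pi\mid\alpha$, and otherwise let $\left(\frac{\alpha}{\pi}\right)_4\in\{1,i,-1,-i\}$ be determined by $\alpha^{(N\pi-1)/4}\equiv\left(\frac{\alpha}{\pi}\right)_4\pmod\pi$. For $\beta\in\mathbb Z[i]$ of odd norm, the quartic Jacobi symbol $\left(\frac{\alpha}{\beta}\right)_4$ is the product of the symbols $\left(\frac{\alpha}{\pi}\right)_4$ over the prime factors $\pi$ of $\beta$, counted with multiplicity (it is $1$ if $\beta$ is a unit). For an odd integer $m$ and rationals $a,b$ whose denominators are prime to $m$, put $\left(\frac{a+bi}{m}\right)_4=\left(\frac{n(a+bi)}{m}\right)_4\left(\frac{n}{m}\right)_4^{-1}$, where $n$ is a common denominator of $a$ and $b$ that is prime to $m$. Let $p$ be a prime with $p\equiv 1\pmod 4$, and let $q$ be an odd integer (of either sign) with $p\nmid q$. Suppose that $p=c^2+d^2=x^2+2qy^2$ with $c,d,x,y\in\mathbb Z$, $c\equiv 1\pmod 4$, $d=2^rd_0$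 with an integer $r\ge 0$, $d_0\equiv 1\pmod 4$ and $\gcd(d_0,x+c)=1$. (These conditions force $p\equiv 1\pmod 8$, $4\mid d$, $2\mid y$, $2\nmid x$, $p\nmid c$ and $x+c\neq 0$, and $x+c$ is prime to $q$.) If $k$ is an integer with $$\left(\frac{-d/(x+c)+i}{q}\right)_4=i^k,$$ then $$(-q)^{\frac{p-1}8}\equiv\begin{cases}(-1)^{\frac{x+1}2\cdot\frac{q-1}4+\frac d4+\frac y2}\left(\frac dc\right)^k\pmod p&\text{if } q\equiv 1\pmod 4,\\[4pt](-1)^{\frac{x+1}2\cdot\frac{q+1}4}\left(\frac dc\right)^k\pmod p&\text{if } q\equiv 3\pmod 4,\end{cases}$$ where $d/c$ is the quotient of the residue classes of $d$ and $c$ modulo $p$. -/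

import Mathlib

/-- The Gaussian integer `i`. -/
def gaussI : GaussianInt := ⟨0, 1⟩

open Classical in
/-- The quartic residue symbol `(α / π)₄` for a Gaussian prime `π` of odd norm `N π`:
it is the power `i ^ m` with `α ^ ((N π - 1) / 4) ≡ i ^ m (mod π)` if `π ∤ α`,
and it is `0` if `π ∣ α`. -/
noncomputable def quarticResidueSymbol (α π : GaussianInt) : ℂ :=
  if π ∣ α then 0
  else if π ∣ α ^ (((Zsqrtd.norm π).natAbs - 1) / 4) - 1 then 1
  else if π ∣ α ^ (((Zsqrtd.norm π).natAbs - 1) / 4) - gaussI then Complex.I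
  else if π ∣ α ^ (((Zsqrtd.norm π).natAbs - 1) / 4) + 1 then -1
  else if π ∣ α ^ (((Zsqrtd.norm π).natAbs - 1) / 4) + gaussI then -Complex.I
  else 0

/-- The quartic Jacobi symbol `(α / β)₄` for `α, β ∈ ℤ[i]` with `β` of odd norm: the product of the
quartic residue symbols `(α / π)₄` over the prime factors `π` of `β`, with multiplicity.
It is `1` if `β` is a unit. As `(α / π)₄` depends on `π` only up to a unit, the choice of the
factorization does not matter, and `(α / -β)₄ = (α / β)₄`. -/
noncomputable def quarticJacobiSymbol (α β : GaussianInt) : ℂ :=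
  ((UniqueFactorizationMonoid.factors β).map (quarticResidueSymbol α)).prod

/-- The quartic Jacobi symbol `((a + b i) / m)₄` with rational `a`, `b` and an odd integer `m`
that is prime to the denominators of `a` and `b`: for a common denominator `n`, it is
the quotient of `((n a + n b i) / m)₄` by `(n / m)₄`. -/
noncomputable def quarticJacobiSymbolRat (a b : ℚ) (m : ℤ) : ℂ :=
  quarticJacobiSymbol ⟨a.num * b.den, b.num * a.den⟩ (m : GaussianInt) /
    quarticJacobiSymbol ((a.den * b.den : ℕ) : GaussianInt) (m : GaussianInt)

/-!
Put `π = c + di`, a Gaussian prime of norm `p`, and `y = 2 ^ v * y₀` with `y₀` odd. Since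
`-q ≡ x² / (2y²)` modulo `p`, the power `(-q) ^ ((p - 1) / 8)` is, by Euler's criterion modulo `π`,
determined by `(x / π)₄`, `(y₀ / π)₄` and the supplementary law for `1 + i`; quartic reciprocity
between a rational and a Gaussian integer turns the first two symbols into `(π / x)₄` and
`(π / y₀)₄`.

These are tied to `q` by `(x + π)² ≡ 2(x + c)π` modulo every divisor of `p - x² = 2qy²`: the
symbol of `x + π` over `q * y₀ ^ 2` equals `((x + π) / q)₄ * (π / y₀)₄`. To evaluate it, write
`x + π` (for `x ≡ 1` modulo `4`) or `π - x` (for `x ≡ 3`) as `2gα` with `g` rational and `α`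
of odd norm, and apply reciprocity to `α`, modulo which `qy² / g` is a rational multiple of `x`.
Finally `-d / (x + c) + i` is `i(x + π) / (x + c)`, and rational integers prime to `q` have
trivial symbol over `q`.
-/

theorem gaussI_sq : gaussI ^ 2 = -1 := by
  rw [sq]; ext <;> simp [gaussI]

theorem gaussI_pow_four : gaussI ^ 4 = 1 := by
  rw [show 4 = 2 * 2 from rfl, pow_mul, gaussI_sq, neg_one_sq]

theorem isUnit_gaussI : IsUnit gaussI :=
  IsUnit.of_pow_eq_one gaussI_pow_four four_ne_zero

theorem star_gaussI : star gaussI = -gaussI := by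
  ext <;> simp [gaussI]

theorem eq_re_add_im_mul_gaussI (z : GaussianInt) : z = z.re + z.im * gaussI := by
  ext <;> simp [gaussI]

theorem mk_eq_add_mul_gaussI (a b : ℤ) : (⟨a, b⟩ : GaussianInt) = a + b * gaussI :=
  eq_re_add_im_mul_gaussI ⟨a, b⟩

theorem star_eq_re_sub_im_mul_gaussI (z : GaussianInt) : star z = z.re - z.im * gaussI := by
  ext <;> simp [gaussI]

section ZModFour

theorem four_eq_zero_zmod_four : (4 : ZMod 4) = 0 := rfl

theorem two_mul_intCast_of_odd {m : ℤ} (hm : Odd m) : (2 * m : ZMod 4) = 2 := by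
  obtain ⟨k, rfl⟩ := hm
  push_cast
  linear_combination (k : ZMod 4) * four_eq_zero_zmod_four

theorem intCast_sq_of_odd {m : ℤ} (hm : Odd m) : (m ^ 2 : ZMod 4) = 1 := by
  obtain ⟨k, rfl⟩ := hm
  push_cast
  linear_combination (k ^ 2 + k : ZMod 4) * four_eq_zero_zmod_four

theorem four_nsmul_zmod_four (n : ZMod 4) : 4 • n = 0 := by
  decide +revert

end ZModFour

section PowersOfI

variable {R : Type*} [CommRing R] (φ : GaussianInt →+* R)

theorem map_gaussI_sq : φ gaussI ^ 2 = -1 := by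
  rw [← map_pow, gaussI_sq, map_neg, map_one]

theorem map_gaussI_pow_four : φ gaussI ^ 4 = 1 := by
  rw [← map_pow, gaussI_pow_four, map_one]

/-- The powers of the image of `i` in a ring `R` over `ℤ[i]`, as a character of `ℤ/4`. A value
`i ^ n` of a quartic symbol is written `iPow GaussianInt.toComplex n`, and its residue class in `R`
is then `iPow φ n`. -/
def iPow : AddChar (ZMod 4) R :=
  AddChar.zmodChar 4 (map_gaussI_pow_four φ)

theorem iPow_natCast (n : ℕ) : iPow φ n = φ gaussI ^ n :=
  AddChar.zmodChar_apply' _ n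

theorem iPow_one : iPow φ 1 = φ gaussI := by
  simpa only [Nat.cast_one, pow_one] using iPow_natCast φ 1

theorem iPow_two : iPow φ 2 = -1 := by
  simpa only [Nat.cast_ofNat, map_gaussI_sq] using iPow_natCast φ 2

theorem iPow_add_two (n : ZMod 4) : iPow φ (n + 2) = -iPow φ n := by
  rw [AddChar.map_add_eq_mul, iPow_two, mul_neg_one]

theorem map_iPow {S : Type*} [CommRing S] (f : R →+* S) (n : ZMod 4) :
    f (iPow φ n) = iPow (f.comp φ) n := by
  rw [← ZMod.natCast_zmod_val n, iPow_natCast, iPow_natCast, map_pow, RingHom.comp_apply]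

theorem iPow_injective (h2 : (2 : R) ≠ 0) : Function.Injective (iPow φ) := by
  have hroot : IsPrimitiveRoot (φ gaussI) 4 := by
    refine IsPrimitiveRoot.iff_orderOf.2 (orderOf_eq_prime_pow (p := 2) (n := 1) ?_ ?_)
    · rw [pow_one, map_gaussI_sq]
      exact fun h => h2 (by linear_combination -h)
    · exact map_gaussI_pow_four φ
  intro m n h
  rw [← ZMod.natCast_zmod_val m, ← ZMod.natCast_zmod_val n, iPow_natCast, iPow_natCast] at h
  exact ZMod.val_injective 4 (hroot.pow_inj m.val_lt n.val_lt h)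

theorem exists_eq_iPow [IsDomain R] {a : R} (ha : a ^ 4 = 1) : ∃ n, a = iPow φ n := by
  have hI := map_gaussI_sq φ
  have hfactor : (a - 1) * (a - φ gaussI) * (a + 1) * (a + φ gaussI) = 0 := by
    linear_combination ha + (1 - a ^ 2) * hI
  rcases mul_eq_zero.1 hfactor with h | h
  · rcases mul_eq_zero.1 h with h | h
    · rcases mul_eq_zero.1 h with h | h
      · exact ⟨0, by rw [AddChar.map_zero_eq_one]; exact sub_eq_zero.1 h⟩
      · exact ⟨1, by rw [iPow_one]; exact sub_eq_zero.1 h⟩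
    · exact ⟨2, by rw [iPow_two]; exact eq_neg_of_add_eq_zero_left h⟩
  · exact ⟨1 + 2, by rw [iPow_add_two, iPow_one]; exact eq_neg_of_add_eq_zero_left h⟩

theorem iPow_intCast {K : Type*} [Field K] (φ : GaussianInt →+* K) (n : ℤ) :
    iPow φ n = φ gaussI ^ n := by
  rw [← zsmul_one n, AddChar.map_zsmul_eq_zpow, iPow_one]

end PowersOfI

theorem toComplex_gaussI : GaussianInt.toComplex gaussI = Complex.I := by
  simp [GaussianInt.toComplex_def, gaussI]

theorem iPow_toComplex_intCast (n : ℤ) : iPow GaussianInt.toComplex n = Complex.I ^ n := by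
  rw [iPow_intCast, toComplex_gaussI]

theorem iPow_toComplex_injective : Function.Injective (iPow GaussianInt.toComplex) :=
  iPow_injective _ two_ne_zero

theorem iPow_toComplex_ne_zero (n : ZMod 4) : iPow GaussianInt.toComplex n ≠ 0 :=
  ((iPow GaussianInt.toComplex).val_isUnit n).ne_zero

section Frobenius

variable {R : Type*} [CommRing R] (φ : GaussianInt →+* R) (l : ℕ) [Fact l.Prime] [CharP R l]

theorem intCast_pow_char (a : ℤ) : (a : R) ^ l = a := by
  rw [← frobenius_def, map_intCast]

theorem map_pow_char_of_mod_four_eq_one (h : l % 4 = 1) (z : GaussianInt) : φ z ^ l = φ z := by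
  have hI : φ gaussI ^ l = φ gaussI := by
    rw [pow_eq_pow_mod l (map_gaussI_pow_four φ), h, pow_one]
  rw [eq_re_add_im_mul_gaussI z, map_add, map_mul, map_intCast, map_intCast, add_pow_char,
    mul_pow, hI, intCast_pow_char, intCast_pow_char]

theorem map_pow_char_of_mod_four_eq_three (h : l % 4 = 3) (z : GaussianInt) :
    φ z ^ l = φ (star z) := by
  have hI : φ gaussI ^ l = -φ gaussI := by
    rw [pow_eq_pow_mod l (map_gaussI_pow_four φ), h, pow_succ, map_gaussI_sq, neg_one_mul]
  rw [star_eq_re_sub_im_mul_gaussI]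
  conv_lhs => rw [eq_re_add_im_mul_gaussI z]
  rw [map_add, map_sub, map_mul, map_intCast, map_intCast, add_pow_char, mul_pow, hI,
    intCast_pow_char, intCast_pow_char, mul_neg, sub_eq_add_neg]

end Frobenius

section OddGaussianPrimes

variable {π : GaussianInt}

theorem exists_natPrime_dvd_of_gaussianPrime (hπ : Prime π) :
    ∃ l : ℕ, l.Prime ∧ π ∣ (l : GaussianInt) := by
  have h0 : (Zsqrtd.norm π).natAbs ≠ 0 := by
    simpa only [ne_eq, Int.natAbs_eq_zero, GaussianInt.norm_eq_zero] using hπ.ne_zero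
  have hdvd : π ∣ ((Zsqrtd.norm π).natAbs.primeFactorsList.map Nat.cast).prod := by
    rw [← Nat.cast_list_prod, Nat.prod_primeFactorsList h0, ← Int.cast_natCast,
      GaussianInt.abs_natCast_norm, Zsqrtd.norm_eq_mul_conj]
    exact dvd_mul_right π (star π)
  obtain ⟨_, hl, hdvd⟩ := hπ.dvd_prod_iff.1 hdvd
  obtain ⟨l, hl', rfl⟩ := List.mem_map.1 hl
  exact ⟨l, Nat.prime_of_mem_primeFactorsList hl', hdvd⟩

theorem odd_norm_of_dvd {α β : GaussianInt} (h : α ∣ β) (hβ : Odd β.norm) : Odd α.norm := by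
  obtain ⟨γ, rfl⟩ := h
  rw [Zsqrtd.norm_mul] at hβ
  exact (Int.odd_mul.1 hβ).1

theorem ne_zero_of_odd_norm {β : GaussianInt} (hβ : Odd β.norm) : β ≠ 0 := by
  rintro rfl
  simp at hβ

theorem natAbs_norm_natCast (l : ℕ) : (Zsqrtd.norm (l : GaussianInt)).natAbs = l ^ 2 := by
  rw [Zsqrtd.norm_natCast, Int.natAbs_mul, Int.natAbs_natCast, sq]

theorem natAbs_norm_eq_or_associated (hπ : Prime π) {l : ℕ} (hl : l.Prime)
    (hd : π ∣ (l : GaussianInt)) : (Zsqrtd.norm π).natAbs = l ∨ Associated π l := by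
  obtain ⟨κ, hκ⟩ := hd
  by_cases hu : (Zsqrtd.norm κ).natAbs = 1
  · exact .inr ⟨(Zsqrtd.norm_eq_one_iff.1 hu).unit, hκ.symm⟩
  · have hnorm : (Zsqrtd.norm π).natAbs * (Zsqrtd.norm κ).natAbs = l ^ 2 := by
      rw [← Int.natAbs_mul, ← Zsqrtd.norm_mul, ← hκ, natAbs_norm_natCast]
    have hπ1 : (Zsqrtd.norm π).natAbs ≠ 1 := fun h => hπ.not_isUnit (Zsqrtd.norm_eq_one_iff.1 h)
    exact .inl ((hl.mul_eq_prime_sq_iff hπ1 hu).1 hnorm).1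

theorem exists_natPrime_of_odd_norm (hπ : Prime π) (ho : Odd π.norm) :
    ∃ l : ℕ, l.Prime ∧ π ∣ (l : GaussianInt) ∧
      (l % 4 = 1 ∧ (Zsqrtd.norm π).natAbs = l ∨ l % 4 = 3 ∧ Associated π l) := by
  obtain ⟨l, hl, hd⟩ := exists_natPrime_dvd_of_gaussianPrime hπ
  have : Fact l.Prime := ⟨hl⟩
  have hassoc : Associated π l ↔ l % 4 = 3 := by
    rw [← GaussianInt.prime_iff_mod_four_eq_three_of_nat_prime]
    exact ⟨fun h => h.prime hπ, fun h => hπ.associated_of_dvd h hd⟩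
  refine ⟨l, hl, hd, ?_⟩
  rcases natAbs_norm_eq_or_associated hπ hl hd with h | h
  · have hlo : Odd l := h ▸ Int.natAbs_odd.2 ho
    have h3 : l % 4 ≠ 3 := fun h3 => by
      have hsq : l ^ 2 = l := by
        rw [← natAbs_norm_natCast, ← Zsqrtd.norm_eq_of_associated (by norm_num) (hassoc.2 h3), h]
      nlinarith [hl.two_le]
    exact .inl ⟨by grind, h⟩
  · exact .inr ⟨hassoc.1 h, h⟩

end OddGaussianPrimes

section ResidueField

variable {K : Type*} [Field K] (φ : GaussianInt →+* K) {π : GaussianInt}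

theorem map_ne_zero_of_isCoprime {α β : GaussianInt} (h : IsCoprime α β) (hβ : φ β = 0) :
    φ α ≠ 0 := by
  have h := h.map φ
  rw [hβ, isCoprime_zero_right] at h
  exact h.ne_zero

theorem map_eq_zero_iff_gaussianPrime_dvd (hπ : Prime π) (h0 : φ π = 0) (α : GaussianInt) :
    φ α = 0 ↔ π ∣ α := by
  refine ⟨fun hα => ?_, fun h => eq_zero_of_zero_dvd (h0 ▸ map_dvd φ h)⟩
  by_contra hd
  exact map_ne_zero_of_isCoprime φ ((Prime.coprime_iff_not_dvd hπ).2 hd).symm h0 hα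

theorem two_ne_zero_of_map_eq_zero (ho : Odd π.norm) (h0 : φ π = 0) : (2 : K) ≠ 0 := by
  intro h2
  obtain ⟨k, hk⟩ := ho
  have h : φ (Zsqrtd.norm π : GaussianInt) = 0 := by
    rw [Zsqrtd.norm_eq_mul_conj, map_mul, h0, zero_mul]
  rw [hk, map_intCast] at h
  push_cast at h
  rw [h2, zero_mul, zero_add] at h
  exact one_ne_zero h

theorem norm_emod_four (ho : Odd π.norm) : π.norm % 4 = 1 := by
  have h : π.norm = π.re ^ 2 + π.im ^ 2 := by rw [Zsqrtd.norm_def]; ring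
  rw [h] at ho ⊢
  rcases Int.even_or_odd' π.re with ⟨a, ha | ha⟩ <;>
    rcases Int.even_or_odd' π.im with ⟨b, hb | hb⟩ <;>
    rw [ha, hb] at ho ⊢ <;> ring_nf at ho ⊢ <;> grind

theorem natAbs_norm_mod_four (ho : Odd π.norm) : (Zsqrtd.norm π).natAbs % 4 = 1 := by
  have := norm_emod_four ho
  have := GaussianInt.norm_nonneg π
  omega

theorem map_pow_natAbs_norm (hπ : Prime π) (ho : Odd π.norm) (h0 : φ π = 0) (α : GaussianInt) :
    φ α ^ (Zsqrtd.norm π).natAbs = φ α := by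
  obtain ⟨l, hl, hd, h⟩ := exists_natPrime_of_odd_norm hπ ho
  have : Fact l.Prime := ⟨hl⟩
  have hl0 : (l : K) = 0 := by
    rw [← map_natCast φ]
    exact (map_eq_zero_iff_gaussianPrime_dvd φ hπ h0 _).2 hd
  have : CharP K l := (CharP.charP_iff_prime_eq_zero hl).2 hl0
  rcases h with ⟨h4, h⟩ | ⟨h4, h⟩
  · rw [h, map_pow_char_of_mod_four_eq_one φ l h4]
  · rw [Zsqrtd.norm_eq_of_associated (by norm_num) h, natAbs_norm_natCast, sq, pow_mul,
      map_pow_char_of_mod_four_eq_three φ l h4, map_pow_char_of_mod_four_eq_three φ l h4, star_star]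

theorem map_pow_four_mul (hπ : Prime π) (ho : Odd π.norm) (h0 : φ π = 0) {α : GaussianInt}
    (hα : φ α ≠ 0) : (φ α ^ (((Zsqrtd.norm π).natAbs - 1) / 4)) ^ 4 = 1 := by
  have h4 := natAbs_norm_mod_four ho
  apply mul_right_cancel₀ hα
  rw [← pow_mul, Nat.div_mul_cancel (by omega), one_mul, ← pow_succ, Nat.sub_add_cancel (by omega),
    map_pow_natAbs_norm φ hπ ho h0]

end ResidueField

theorem exists_field_ringHom_eq_zero {π : GaussianInt} (hπ : Prime π) :
    ∃ (K : Type) (_ : Field K) (φ : GaussianInt →+* K), φ π = 0 := by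
  have : (Ideal.span {π}).IsPrime := (Ideal.span_singleton_prime hπ.ne_zero).2 hπ
  refine ⟨FractionRing (GaussianInt ⧸ Ideal.span {π}), inferInstance,
    (algebraMap (GaussianInt ⧸ Ideal.span {π}) _).comp (Ideal.Quotient.mk _), ?_⟩
  rw [RingHom.comp_apply, Ideal.Quotient.eq_zero_iff_mem.2 (Ideal.mem_span_singleton_self π),
    map_zero]

/-! ### Quartic residue and Jacobi symbols -/

section ResidueSymbol

variable {π : GaussianInt}

theorem quarticResidueSymbol_eq_iff {K : Type*} [Field K] (φ : GaussianInt →+* K) (hπ : Prime π)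
    (ho : Odd π.norm) (h0 : φ π = 0) {α : GaussianInt} (hα : ¬ π ∣ α) (n : ZMod 4) :
    quarticResidueSymbol α π = iPow GaussianInt.toComplex n ↔
      φ α ^ (((Zsqrtd.norm π).natAbs - 1) / 4) = iPow φ n := by
  have hz := map_eq_zero_iff_gaussianPrime_dvd φ hπ h0
  have h2 := two_ne_zero_of_map_eq_zero φ ho h0
  obtain ⟨m, hm⟩ := exists_eq_iPow φ (map_pow_four_mul φ hπ ho h0 (mt (hz α).1 hα))
  have hsymbol : quarticResidueSymbol α π = iPow GaussianInt.toComplex m := by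
    have hdvd (ξ : GaussianInt) (k : ZMod 4) (hξ : φ ξ = iPow φ k) :
        π ∣ α ^ (((Zsqrtd.norm π).natAbs - 1) / 4) - ξ ↔ m = k := by
      rw [← hz, map_sub, map_pow, hm, hξ, sub_eq_zero, (iPow_injective φ h2).eq_iff]
    rw [quarticResidueSymbol, if_neg hα, ← sub_neg_eq_add _ 1, ← sub_neg_eq_add _ gaussI]
    simp only [hdvd 1 0 (by simp), hdvd gaussI 1 (iPow_one φ).symm,
      hdvd (-1) 2 (by rw [iPow_two, map_neg, map_one]),
      hdvd (-gaussI) (1 + 2) (by rw [iPow_add_two, iPow_one, map_neg])]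
    have hm4 : ∀ m : ZMod 4, m = 0 ∨ m = 1 ∨ m = 2 ∨ m = 1 + 2 := by decide
    obtain rfl | rfl | rfl | rfl := hm4 m
    · simp
    · rw [iPow_one, toComplex_gaussI, if_neg (by decide), if_pos rfl]
    · rw [iPow_two, if_neg (by decide), if_neg (by decide), if_pos rfl]
    · rw [iPow_add_two, iPow_one, toComplex_gaussI, if_neg (by decide), if_neg (by decide),
        if_neg (by decide), if_pos rfl]
  rw [hsymbol, hm, iPow_toComplex_injective.eq_iff, (iPow_injective φ h2).eq_iff]

theorem exists_quarticResidueSymbol_eq_iPow (hπ : Prime π) (ho : Odd π.norm) {α : GaussianInt}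
    (hα : ¬ π ∣ α) : ∃ n, quarticResidueSymbol α π = iPow GaussianInt.toComplex n := by
  obtain ⟨K, _, φ, h0⟩ := exists_field_ringHom_eq_zero hπ
  have hα' : φ α ≠ 0 := mt (map_eq_zero_iff_gaussianPrime_dvd φ hπ h0 α).1 hα
  obtain ⟨n, hn⟩ := exists_eq_iPow φ (map_pow_four_mul φ hπ ho h0 hα')
  exact ⟨n, (quarticResidueSymbol_eq_iff φ hπ ho h0 hα n).2 hn⟩

theorem quarticResidueSymbol_eq_zero_iff (hπ : Prime π) (ho : Odd π.norm) {α : GaussianInt} :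
    quarticResidueSymbol α π = 0 ↔ π ∣ α := by
  refine ⟨fun h => ?_, fun h => if_pos h⟩
  by_contra hα
  obtain ⟨n, hn⟩ := exists_quarticResidueSymbol_eq_iPow hπ ho hα
  exact iPow_toComplex_ne_zero n (hn.symm.trans h)

theorem quarticResidueSymbol_mul (hπ : Prime π) (ho : Odd π.norm) (α β : GaussianInt) :
    quarticResidueSymbol (α * β) π = quarticResidueSymbol α π * quarticResidueSymbol β π := by
  by_cases h : π ∣ α * β
  · rw [(quarticResidueSymbol_eq_zero_iff hπ ho).2 h, eq_comm, mul_eq_zero,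
      quarticResidueSymbol_eq_zero_iff hπ ho, quarticResidueSymbol_eq_zero_iff hπ ho]
    exact hπ.dvd_or_dvd h
  · have hα : ¬ π ∣ α := fun hα => h (hα.mul_right β)
    have hβ : ¬ π ∣ β := fun hβ => h (hβ.mul_left α)
    obtain ⟨K, _, φ, h0⟩ := exists_field_ringHom_eq_zero hπ
    obtain ⟨m, hm⟩ := exists_quarticResidueSymbol_eq_iPow hπ ho hα
    obtain ⟨n, hn⟩ := exists_quarticResidueSymbol_eq_iPow hπ ho hβ
    rw [hm, hn, ← AddChar.map_add_eq_mul, quarticResidueSymbol_eq_iff φ hπ ho h0 h, map_mul,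
      mul_pow, AddChar.map_add_eq_mul, ← (quarticResidueSymbol_eq_iff φ hπ ho h0 hα m).1 hm,
      ← (quarticResidueSymbol_eq_iff φ hπ ho h0 hβ n).1 hn]

theorem quarticResidueSymbol_congr (hπ : Prime π) (ho : Odd π.norm) {α β : GaussianInt}
    (hd : π ∣ α - β) : quarticResidueSymbol α π = quarticResidueSymbol β π := by
  have hdvd : π ∣ α ↔ π ∣ β := by simpa only [sub_add_cancel] using dvd_add_right (c := β) hd
  by_cases hα : π ∣ α
  · rw [(quarticResidueSymbol_eq_zero_iff hπ ho).2 hα,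
      (quarticResidueSymbol_eq_zero_iff hπ ho).2 (hdvd.1 hα)]
  · obtain ⟨K, _, φ, h0⟩ := exists_field_ringHom_eq_zero hπ
    obtain ⟨n, hn⟩ := exists_quarticResidueSymbol_eq_iPow hπ ho hα
    have hφ : φ α = φ β := by
      rw [← sub_eq_zero, ← map_sub, map_eq_zero_iff_gaussianPrime_dvd φ hπ h0]
      exact hd
    rw [hn, eq_comm, quarticResidueSymbol_eq_iff φ hπ ho h0 (mt hdvd.2 hα), ← hφ,
      (quarticResidueSymbol_eq_iff φ hπ ho h0 hα n).1 hn]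

theorem quarticResidueSymbol_of_associated {ρ : GaussianInt} (h : Associated π ρ)
    (α : GaussianInt) : quarticResidueSymbol α π = quarticResidueSymbol α ρ := by
  classical
  have hnorm : π.norm = ρ.norm := Zsqrtd.norm_eq_of_associated (by norm_num) h
  simp only [quarticResidueSymbol, h.dvd_iff_dvd_left, hnorm]

end ResidueSymbol

section JacobiSymbol

open UniqueFactorizationMonoid

variable (α : GaussianInt) {β γ : GaussianInt}

theorem quarticJacobiSymbol_of_associated (h : Associated β γ) :
    quarticJacobiSymbol α β = quarticJacobiSymbol α γ := by
  unfold quarticJacobiSymbol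
  congr 1
  rw [← Multiset.rel_eq, Multiset.rel_map]
  exact (factors_rel_of_associated h).mono
    fun _ _ _ _ h => quarticResidueSymbol_of_associated h α

theorem quarticJacobiSymbol_intCast_neg (m : ℤ) :
    quarticJacobiSymbol α ((-m : ℤ) : GaussianInt) = quarticJacobiSymbol α m := by
  rw [Int.cast_neg]
  exact quarticJacobiSymbol_of_associated α (Associated.refl _).neg_left

theorem quarticJacobiSymbol_mul_right (hβ : β ≠ 0) (hγ : γ ≠ 0) :
    quarticJacobiSymbol α (β * γ) = quarticJacobiSymbol α β * quarticJacobiSymbol α γ := by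
  unfold quarticJacobiSymbol
  rw [← Multiset.prod_add, ← Multiset.map_add]
  congr 1
  rw [← Multiset.rel_eq, Multiset.rel_map]
  exact (factors_mul hβ hγ).mono fun _ _ _ _ h => quarticResidueSymbol_of_associated h α

theorem quarticJacobiSymbol_gaussianPrime (hβ : Prime β) :
    quarticJacobiSymbol α β = quarticResidueSymbol α β := by
  obtain ⟨ρ, hρ, h⟩ := factors_eq_singleton_of_irreducible hβ.irreducible
  rw [quarticJacobiSymbol, h, Multiset.map_singleton, Multiset.prod_singleton,
    quarticResidueSymbol_of_associated hρ]

theorem quarticJacobiSymbol_isUnit (hβ : IsUnit β) : quarticJacobiSymbol α β = 1 := by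
  rw [quarticJacobiSymbol, factors_of_isUnit hβ, Multiset.map_zero, Multiset.prod_zero]

theorem quarticJacobiSymbol_mul_left (hβ : Odd β.norm) (α₁ α₂ : GaussianInt) :
    quarticJacobiSymbol (α₁ * α₂) β = quarticJacobiSymbol α₁ β * quarticJacobiSymbol α₂ β := by
  unfold quarticJacobiSymbol
  rw [← Multiset.prod_map_mul]
  congr 1
  refine Multiset.map_congr rfl fun π hπ => ?_
  exact quarticResidueSymbol_mul (prime_of_factor π hπ)
    (odd_norm_of_dvd (dvd_of_mem_factors hπ) hβ) α₁ α₂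

theorem quarticJacobiSymbol_congr (hβ : Odd β.norm) {α₁ α₂ : GaussianInt} (h : β ∣ α₁ - α₂) :
    quarticJacobiSymbol α₁ β = quarticJacobiSymbol α₂ β := by
  unfold quarticJacobiSymbol
  congr 1
  refine Multiset.map_congr rfl fun π hπ => ?_
  exact quarticResidueSymbol_congr (prime_of_factor π hπ)
    (odd_norm_of_dvd (dvd_of_mem_factors hπ) hβ) ((dvd_of_mem_factors hπ).trans h)

variable {α}

theorem exists_quarticJacobiSymbol_eq_iPow (hβ : Odd β.norm) (h : IsCoprime α β) :
    ∃ n, quarticJacobiSymbol α β = iPow GaussianInt.toComplex n := by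
  refine Multiset.prod_induction (fun z => ∃ n, z = iPow GaussianInt.toComplex n) _ ?_ ?_ ?_
  · rintro _ _ ⟨m, rfl⟩ ⟨n, rfl⟩
    exact ⟨m + n, (AddChar.map_add_eq_mul _ m n).symm⟩
  · exact ⟨0, (AddChar.map_zero_eq_one _).symm⟩
  · intro z hz
    obtain ⟨π, hπ, rfl⟩ := Multiset.mem_map.1 hz
    have hprime := prime_of_factor π hπ
    have hdvd := dvd_of_mem_factors hπ
    exact exists_quarticResidueSymbol_eq_iPow hprime (odd_norm_of_dvd hdvd hβ)
      fun hα => hprime.not_isUnit (h.isUnit_of_dvd' hα hdvd)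

theorem quarticJacobiSymbol_ne_zero (hβ : Odd β.norm) (h : IsCoprime α β) :
    quarticJacobiSymbol α β ≠ 0 := by
  obtain ⟨n, hn⟩ := exists_quarticJacobiSymbol_eq_iPow hβ h
  exact hn ▸ iPow_toComplex_ne_zero n

theorem quarticJacobiSymbol_eq_zero (hβ : Odd β.norm) (h : ¬ IsCoprime α β) :
    quarticJacobiSymbol α β = 0 := by
  obtain ⟨π, hπ, hπα, hπβ⟩ : ∃ π, Prime π ∧ π ∣ α ∧ π ∣ β := by
    by_contra! hnone
    exact h (isCoprime_of_prime_dvd (fun h0 => ne_zero_of_odd_norm hβ h0.2) hnone)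
  obtain ⟨ρ, hρ, hassoc⟩ :=
    exists_mem_factors_of_dvd (ne_zero_of_odd_norm hβ) hπ.irreducible hπβ
  refine Multiset.prod_eq_zero (Multiset.mem_map.2 ⟨ρ, hρ, ?_⟩)
  rw [← quarticResidueSymbol_of_associated hassoc]
  exact if_pos hπα

theorem odd_norm_intCast {m : ℤ} (hm : Odd m) : Odd (Zsqrtd.norm (m : GaussianInt)) := by
  rw [Zsqrtd.norm_intCast]
  exact hm.mul hm

theorem quarticJacobiSymbol_intCast_mul_right (α : GaussianInt) {a b : ℤ} (ha : Odd a)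
    (hb : Odd b) : quarticJacobiSymbol α ((a * b : ℤ) : GaussianInt) =
      quarticJacobiSymbol α a * quarticJacobiSymbol α b := by
  rw [Int.cast_mul, quarticJacobiSymbol_mul_right α (ne_zero_of_odd_norm (odd_norm_intCast ha))
    (ne_zero_of_odd_norm (odd_norm_intCast hb))]

end JacobiSymbol

/-- The number `±m` that is congruent to `1` modulo `4`, for odd `m`. -/
def primary (m : ℤ) : ℤ :=
  ZMod.χ₄ m * m

/-- The integer `m'` with `primary m = 1 + 4 * m'`, for odd `m`. -/
def primaryQuarter (m : ℤ) : ℤ :=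
  (primary m - 1) / 4

section Primary

variable {m n : ℤ}

theorem primary_of_emod_four_eq_one (hm : m % 4 = 1) : primary m = m := by
  rw [primary, ZMod.χ₄_int_one_mod_four hm, one_mul]

theorem primary_of_emod_four_eq_three (hm : m % 4 = 3) : primary m = -m := by
  rw [primary, ZMod.χ₄_int_three_mod_four hm, neg_one_mul]

theorem primary_eq_or_eq_neg (hm : Odd m) : primary m = m ∨ primary m = -m := by
  obtain h | h : m % 4 = 1 ∨ m % 4 = 3 := by grind
  · exact .inl (primary_of_emod_four_eq_one h)
  · exact .inr (primary_of_emod_four_eq_three h)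

theorem primary_eq (hm : Odd m) : primary m = 1 + 4 * primaryQuarter m := by
  have h : primary m % 4 = 1 := by
    obtain h | h : m % 4 = 1 ∨ m % 4 = 3 := by grind
    · rw [primary_of_emod_four_eq_one h, h]
    · rw [primary_of_emod_four_eq_three h]; omega
  rw [primaryQuarter]; omega

theorem primary_mul (m n : ℤ) : primary (m * n) = primary m * primary n := by
  simp only [primary, Int.cast_mul, map_mul]
  ring

theorem primary_neg (hm : Odd m) : primary (-m) = primary m := by
  obtain h | h : m % 4 = 1 ∨ m % 4 = 3 := by grind
  · rw [primary_of_emod_four_eq_one h, primary_of_emod_four_eq_three (by omega), neg_neg]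
  · rw [primary_of_emod_four_eq_three h, primary_of_emod_four_eq_one (by omega)]

theorem primaryQuarter_neg (hm : Odd m) : primaryQuarter (-m) = primaryQuarter m := by
  rw [primaryQuarter, primary_neg hm, primaryQuarter]

theorem primaryQuarter_one_add_four_mul (k : ℤ) : primaryQuarter (1 + 4 * k) = k := by
  rw [primaryQuarter, primary_of_emod_four_eq_one (by omega)]
  omega

theorem primaryQuarter_one : primaryQuarter 1 = 0 := by
  rw [primaryQuarter, primary_of_emod_four_eq_one (by norm_num)]; norm_num

theorem primaryQuarter_mul (hm : Odd m) (hn : Odd n) :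
    (primaryQuarter (m * n) : ZMod 4) = primaryQuarter m + primaryQuarter n := by
  have h := primary_mul m n
  rw [primary_eq hm, primary_eq hn, primary_eq (hm.mul hn)] at h
  rw [show primaryQuarter (m * n) =
    primaryQuarter m + primaryQuarter n + 4 * (primaryQuarter m * primaryQuarter n) by linarith]
  push_cast
  rw [four_eq_zero_zmod_four, zero_mul, add_zero]

@[elab_as_elim]
theorem odd_induction {P : ∀ m : ℤ, Odd m → Prop} (one : P 1 odd_one)
    (neg : ∀ m hm, P m hm → P (-m) hm.neg)
    (prime : ∀ (l : ℕ) (_ : l.Prime) (hlo : Odd (l : ℤ)), P l hlo)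
    (mul : ∀ a b ha hb, P a ha → P b hb → P (a * b) (ha.mul hb)) (m : ℤ) (hm : Odd m) : P m hm := by
  have natCast (n : ℕ) : ∀ hn : Odd (n : ℤ), P n hn := by
    induction n using Nat.recOnMul with
    | zero => intro h; simp at h
    | one => simpa using one
    | prime p hp => exact prime p hp
    | mul a b ha hb =>
      rw [Nat.cast_mul]
      intro h
      obtain ⟨h1, h2⟩ := Int.odd_mul.1 h
      exact mul _ _ h1 h2 (ha h1) (hb h2)
  have hodd : Odd (m.natAbs : ℤ) := (Int.odd_coe_nat _).2 (Int.natAbs_odd.2 hm)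
  obtain h | h := Int.natAbs_eq m <;> generalize m.natAbs = n at * <;> subst h
  · exact natCast n hm
  · exact neg n hodd (natCast n hodd)

end Primary

section Star

theorem gaussianPrime_star {π : GaussianInt} (hπ : Prime π) : Prime (star π) :=
  (MulEquiv.prime_iff (starMulAut (R := GaussianInt))).2 hπ

theorem isCoprime_star {α : GaussianInt} {m : ℤ} (h : IsCoprime α m) :
    IsCoprime (star α) (m : GaussianInt) := by
  simpa only [starRingEnd_apply, star_intCast] using h.map (starRingEnd GaussianInt)

theorem iPow_comp_star {R : Type*} [CommRing R] (φ : GaussianInt →+* R) (n : ZMod 4) :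
    iPow (φ.comp (starRingEnd GaussianInt)) n = iPow φ (-n) := by
  have hI : iPow (φ.comp (starRingEnd GaussianInt)) 1 = iPow φ (1 + 2) := by
    rw [iPow_add_two, iPow_one, iPow_one, RingHom.comp_apply, starRingEnd_apply, star_gaussI,
      map_neg]
  have hn : n.val • (1 : ZMod 4) = n := by rw [nsmul_one, ZMod.natCast_zmod_val]
  rw [← hn, AddChar.map_nsmul_eq_pow, hI, ← AddChar.map_nsmul_eq_pow,
    show -(n.val • (1 : ZMod 4)) = n.val • (1 + 2) by rw [← smul_neg]; rfl]

end Star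

theorem gaussianPrime_of_norm_eq_natPrime {l : ℕ} (hl : l.Prime) {π : GaussianInt}
    (hπ : π.norm = l) : Prime π := by
  rw [← irreducible_iff_prime]
  refine ⟨fun hu => ?_, fun x y hxy => ?_⟩
  · rw [← Zsqrtd.norm_eq_one_iff, hπ] at hu
    exact hl.one_lt.ne' (by simpa using hu)
  · have hmul : (Zsqrtd.norm x).natAbs * (Zsqrtd.norm y).natAbs = l := by
      rw [← Int.natAbs_mul, ← Zsqrtd.norm_mul, ← hxy, hπ, Int.natAbs_natCast]
    rw [← Zsqrtd.norm_eq_one_iff, ← Zsqrtd.norm_eq_one_iff]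
    exact (Nat.prime_mul_iff.1 (hmul ▸ hl)).symm.imp And.right And.right

section CharL

variable {K : Type*} [Field K] (φ : GaussianInt →+* K) {l : ℕ} [hl : Fact l.Prime] [CharP K l]

theorem exists_norm_eq_map_eq_zero (h4 : l % 4 = 1) : ∃ π : GaussianInt, π.norm = l ∧ φ π = 0 := by
  obtain ⟨a, b, hab⟩ := Nat.Prime.sq_add_sq (p := l) (by omega)
  have hnorm : Zsqrtd.norm (⟨a, b⟩ : GaussianInt) = l := by
    rw [Zsqrtd.norm_def, ← hab]; push_cast; ring
  have hmul : φ ⟨a, b⟩ * φ (star ⟨a, b⟩) = 0 := by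
    rw [← map_mul, ← Zsqrtd.norm_eq_mul_conj, hnorm, Int.cast_natCast, map_natCast,
      CharP.cast_eq_zero]
  rcases mul_eq_zero.1 hmul with h0 | h0
  · exact ⟨_, hnorm, h0⟩
  · exact ⟨_, by rw [Zsqrtd.norm_conj, hnorm], h0⟩

theorem map_div_star_pow_of_mod_four_eq_one (h4 : l % 4 = 1) {α : GaussianInt}
    (hα : IsCoprime α (l : GaussianInt)) {n : ZMod 4}
    (h : quarticJacobiSymbol α l = iPow GaussianInt.toComplex n) :
    (φ α / φ (star α)) ^ ((l - 1) / 4) = iPow φ n := by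
  obtain ⟨π, hnorm, h0⟩ := exists_norm_eq_map_eq_zero φ h4
  have hmul : (l : GaussianInt) = π * star π := by
    rw [← Zsqrtd.norm_eq_mul_conj, hnorm, Int.cast_natCast]
  have hπ := gaussianPrime_of_norm_eq_natPrime hl.out hnorm
  have ho : Odd π.norm := hnorm ▸ (Int.odd_coe_nat l).2 (Nat.odd_iff.2 (by omega))
  have hπ' := gaussianPrime_star hπ
  have ho' : Odd (star π).norm := by rwa [Zsqrtd.norm_conj]
  have hd : ¬ π ∣ α := fun hd => hπ.not_isUnit
    (hα.isUnit_of_dvd' hd (hmul ▸ dvd_mul_right _ _))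
  have hd' : ¬ star π ∣ α := fun hd => hπ'.not_isUnit
    (hα.isUnit_of_dvd' hd (hmul ▸ dvd_mul_left _ _))
  obtain ⟨a, ha⟩ := exists_quarticResidueSymbol_eq_iPow hπ ho hd
  obtain ⟨b, hb⟩ := exists_quarticResidueSymbol_eq_iPow hπ' ho' hd'
  have hn : a + b = n := by
    rw [hmul, quarticJacobiSymbol_mul_right α hπ.ne_zero hπ'.ne_zero,
      quarticJacobiSymbol_gaussianPrime α hπ, quarticJacobiSymbol_gaussianPrime α hπ', ha, hb,
      ← AddChar.map_add_eq_mul] at h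
    exact iPow_toComplex_injective h
  rw [quarticResidueSymbol_eq_iff φ hπ ho h0 hd, hnorm] at ha
  rw [quarticResidueSymbol_eq_iff (φ.comp (starRingEnd GaussianInt)) hπ' ho'
    (by rw [RingHom.comp_apply, starRingEnd_apply, star_star, h0]) hd', iPow_comp_star,
    Zsqrtd.norm_conj, hnorm, RingHom.comp_apply, starRingEnd_apply] at hb
  rw [Int.natAbs_natCast] at ha hb
  rw [div_pow, ha, hb, div_eq_iff ((iPow φ).val_isUnit _).ne_zero, ← AddChar.map_add_eq_mul, ← hn,
    add_neg_cancel_right]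

theorem map_div_star_pow_of_mod_four_eq_three (h4 : l % 4 = 3) {α : GaussianInt}
    (hα : IsCoprime α (l : GaussianInt)) {n : ZMod 4}
    (h : quarticJacobiSymbol α l = iPow GaussianInt.toComplex n) :
    (φ (star α) / φ α) ^ ((l + 1) / 4) = iPow φ n := by
  have hπ : Prime (l : GaussianInt) := GaussianInt.prime_of_nat_prime_of_mod_four_eq_three l h4
  have ho : Odd (Zsqrtd.norm (l : GaussianInt)) :=
    Int.natAbs_odd.1 (by rw [natAbs_norm_natCast]; exact (Nat.odd_iff.2 (by omega)).pow)
  have h0 : φ l = 0 := by rw [map_natCast, CharP.cast_eq_zero]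
  have hd : ¬ (l : GaussianInt) ∣ α := fun hd => hπ.not_isUnit (hα.isUnit_of_dvd' hd dvd_rfl)
  rw [quarticJacobiSymbol_gaussianPrime α hπ, quarticResidueSymbol_eq_iff φ hπ ho h0 hd,
    natAbs_norm_natCast] at h
  obtain ⟨k, rfl⟩ : ∃ k, l = 4 * k + 3 := ⟨l / 4, by omega⟩
  have hexp : ((4 * k + 3) ^ 2 - 1) / 4 = (4 * k + 2) * (k + 1) := by
    rw [show (4 * k + 3) ^ 2 = 4 * ((4 * k + 2) * (k + 1)) + 1 by ring, Nat.add_sub_cancel,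
      Nat.mul_div_cancel_left _ (by norm_num)]
  rw [← h, hexp, ← map_pow_char_of_mod_four_eq_three φ _ h4, pow_succ _ (4 * k + 2),
    mul_div_cancel_right₀ _ (map_ne_zero_of_isCoprime φ hα h0), ← pow_mul,
    show (4 * k + 3 + 1) / 4 = k + 1 by omega]

theorem two_ne_zero_of_charP_odd (hlo : Odd (l : ℤ)) : (2 : K) ≠ 0 := by
  refine Ring.two_ne_zero ?_
  rw [← CharP.eq K ‹CharP K l› (ringChar.charP K)]
  rintro rfl
  revert hlo; decide

theorem quarticJacobiSymbol_natPrime_eq_iff (hlo : Odd (l : ℤ)) {α : GaussianInt}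
    (hα : IsCoprime α (l : GaussianInt)) (n : ZMod 4) :
    quarticJacobiSymbol α l = iPow GaussianInt.toComplex n ↔
      (φ α / φ (star α)) ^ primaryQuarter l = iPow φ n := by
  obtain ⟨k, hk⟩ := exists_quarticJacobiSymbol_eq_iPow
    (by simpa using odd_norm_intCast hlo) hα
  have hpow : (φ α / φ (star α)) ^ primaryQuarter l = iPow φ k := by
    obtain h4 | h4 : l % 4 = 1 ∨ l % 4 = 3 := by grind
    · rw [← map_div_star_pow_of_mod_four_eq_one φ h4 hα hk, primaryQuarter,
        primary_of_emod_four_eq_one (by omega), ← zpow_natCast]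
      congr 1; omega
    · rw [← map_div_star_pow_of_mod_four_eq_three φ h4 hα hk, primaryQuarter,
        primary_of_emod_four_eq_three (by omega), ← inv_div, inv_zpow', ← zpow_natCast]
      congr 1; omega
  rw [hk, hpow, iPow_toComplex_injective.eq_iff,
    (iPow_injective φ (two_ne_zero_of_charP_odd hlo)).eq_iff]

end CharL

theorem nonempty_ringHom_algebraicClosure (l : ℕ) [Fact l.Prime] :
    Nonempty (GaussianInt →+* AlgebraicClosure (ZMod l)) := by
  obtain ⟨j, hj⟩ := IsAlgClosed.exists_pow_nat_eq (-1 : AlgebraicClosure (ZMod l)) two_pos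
  exact ⟨Zsqrtd.lift ⟨j, by rw [← sq, hj]; norm_num⟩⟩

section Supplements

variable {m : ℤ}

theorem quarticJacobiSymbol_of_eq_iPow_mul_star {α : GaussianInt} {k : ZMod 4}
    (hα : α = iPow (RingHom.id GaussianInt) k * star α) (hm : Odd m)
    (h : IsCoprime α (m : GaussianInt)) :
    quarticJacobiSymbol α m = iPow GaussianInt.toComplex (k * primaryQuarter m) := by
  induction m, hm using odd_induction with
  | one =>
    rw [Int.cast_one, quarticJacobiSymbol_isUnit α isUnit_one, primaryQuarter_one, Int.cast_zero,
      mul_zero, AddChar.map_zero_eq_one]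
  | neg m hm ih =>
    rw [Int.cast_neg, IsCoprime.neg_right_iff] at h
    rw [quarticJacobiSymbol_intCast_neg, primaryQuarter_neg hm, ih h]
  | prime l hl hlo =>
    have : Fact l.Prime := ⟨hl⟩
    obtain ⟨φ⟩ := nonempty_ringHom_algebraicClosure l
    rw [Int.cast_natCast] at h ⊢
    have hφ : φ (star α) ≠ 0 := by
      refine map_ne_zero_of_isCoprime φ (β := l) ?_ (by rw [map_natCast, CharP.cast_eq_zero])
      simpa only [Int.cast_natCast] using isCoprime_star (m := l) (by simpa using h)
    have hdiv : φ α / φ (star α) = iPow φ k := by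
      rw [div_eq_iff hφ]
      conv_lhs => rw [hα, map_mul, map_iPow, RingHom.comp_id]
    rw [quarticJacobiSymbol_natPrime_eq_iff φ hlo h, hdiv, ← AddChar.map_zsmul_eq_zpow,
      zsmul_eq_mul, mul_comm]
  | mul a b ha hb iha ihb =>
    rw [Int.cast_mul, IsCoprime.mul_right_iff] at h
    rw [quarticJacobiSymbol_intCast_mul_right α ha hb, iha h.1, ihb h.2, ← AddChar.map_add_eq_mul,
      primaryQuarter_mul ha hb, mul_add]

theorem quarticJacobiSymbol_intCast_intCast {a : ℤ} (hm : Odd m) (h : IsCoprime a m) :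
    quarticJacobiSymbol a m = 1 := by
  rw [quarticJacobiSymbol_of_eq_iPow_mul_star (k := 0) (by simp) hm (h.intCast),
    zero_mul, AddChar.map_zero_eq_one]

theorem quarticJacobiSymbol_gaussI_intCast (hm : Odd m) :
    quarticJacobiSymbol gaussI m = iPow GaussianInt.toComplex (2 * primaryQuarter m) :=
  quarticJacobiSymbol_of_eq_iPow_mul_star (by rw [iPow_two, star_gaussI, neg_mul_neg, one_mul]) hm
    (isCoprime_one_left.of_isCoprime_of_dvd_left isUnit_gaussI.dvd)

theorem isCoprime_one_add_gaussI (hm : Odd m) : IsCoprime (1 + gaussI) (m : GaussianInt) := by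
  obtain ⟨k, rfl⟩ := hm
  refine ⟨-k * (1 - gaussI), 1, ?_⟩
  push_cast
  linear_combination (k : GaussianInt) * gaussI_sq

theorem quarticJacobiSymbol_one_sub_gaussI_intCast (hm : Odd m) :
    quarticJacobiSymbol (1 - gaussI) m = iPow GaussianInt.toComplex (-primaryQuarter m) := by
  have hcop := isCoprime_star (isCoprime_one_add_gaussI hm)
  rw [star_add, star_one, star_gaussI, ← sub_eq_add_neg] at hcop
  rw [quarticJacobiSymbol_of_eq_iPow_mul_star (k := 1 + 2) _ hm hcop,
    show (1 + 2 : ZMod 4) = -1 from rfl, neg_one_mul]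
  rw [iPow_add_two, iPow_one, star_sub, star_one, star_gaussI, RingHom.id_apply]
  linear_combination gaussI_sq

end Supplements

/-! ### Gauss sums and quartic reciprocity -/

theorem natCast_ne_zero_of_prime_ne {R : Type*} [Ring R] {l p : ℕ} [CharP R l] (hl : l.Prime)
    (hp : p.Prime) (h : l ≠ p) : (p : R) ≠ 0 := by
  rwa [ne_eq, CharP.cast_eq_zero_iff R l, Nat.prime_dvd_prime_iff_eq hl hp]

theorem sum_pow_mul_one_sub_pow_zmod {p : ℕ} [Fact p.Prime] {f : ℕ} (hf : 2 * f < p - 1) :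
    ∑ a : ZMod p, a ^ f * (1 - a) ^ f = 0 := by
  have hexpand (a : ZMod p) : a ^ f * (1 - a) ^ f =
      ∑ k ∈ Finset.range (f + 1), ((-1) ^ k * (f.choose k : ZMod p)) * a ^ (f + k) := by
    rw [sub_eq_neg_add, add_pow, Finset.mul_sum]
    refine Finset.sum_congr rfl fun k _ => ?_
    rw [neg_pow, one_pow, pow_add]
    ring
  simp_rw [hexpand]
  rw [Finset.sum_comm]
  refine Finset.sum_eq_zero fun k hk => ?_
  have := Finset.mem_range.1 hk
  rw [← Finset.mul_sum, FiniteField.sum_pow_lt_card_sub_one, mul_zero]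
  rw [ZMod.card]
  omega

theorem odd_re_of_odd_norm {α : GaussianInt} (hα : Odd α.norm) (him : Even α.im) : Odd α.re := by
  rw [Zsqrtd.norm_def, Int.odd_sub, iff_true_right (him.mul_left _)] at hα
  exact (Int.odd_mul.1 hα).1

theorem sq_eq_one_of_norm_eq_one {κ : GaussianInt} (hκ : κ.norm = 1) (him : Even κ.im) :
    κ ^ 2 = 1 := by
  rw [Zsqrtd.norm_def] at hκ
  obtain ⟨k, hk⟩ := him
  have hk0 : k = 0 := by nlinarith
  rw [hk, hk0] at hκ
  rw [sq]
  ext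
  · rw [Zsqrtd.re_mul, hk, hk0, Zsqrtd.re_one]
    linarith
  · rw [Zsqrtd.im_mul, hk, hk0, Zsqrtd.im_one]
    ring

section QuarticCharacter

variable {p : ℕ} [Fact p.Prime]

/-- `χ` is the `ℤ[i]`-valued quartic residue character of `𝔽_p`, where `p % 4 = 1` and the
homomorphism `ρ : ℤ[i] → 𝔽_p` fixes the Gaussian prime above `p`. -/
def IsQuarticCharacter (ρ : GaussianInt →+* ZMod p) (χ : MulChar (ZMod p) GaussianInt) : Prop :=
  ∀ a : (ZMod p)ˣ, ∃ n, χ a = iPow (RingHom.id _) n ∧ (a : ZMod p) ^ ((p - 1) / 4) = iPow ρ n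

theorem two_ne_zero_zmod (hp : p % 4 = 1) : (2 : ZMod p) ≠ 0 :=
  two_ne_zero_of_charP_odd (l := p) ((Int.odd_coe_nat p).2 (Nat.odd_iff.2 (by omega)))

theorem exists_isQuarticCharacter (ρ : GaussianInt →+* ZMod p) (hp : p % 4 = 1) :
    ∃ χ, IsQuarticCharacter ρ χ := by
  have hlog (a : (ZMod p)ˣ) : ∃ n, (a : ZMod p) ^ ((p - 1) / 4) = iPow ρ n :=
    exists_eq_iPow ρ (by
      rw [← pow_mul, Nat.div_mul_cancel (by omega), ZMod.pow_card_sub_one_eq_one a.ne_zero])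
  choose f hf using hlog
  have hf_mul (a b : (ZMod p)ˣ) : f (a * b) = f a + f b := by
    apply iPow_injective ρ (two_ne_zero_zmod hp)
    rw [← hf, Units.val_mul, mul_pow, hf, hf, AddChar.map_add_eq_mul]
  have hf_one : f 1 = 0 := by simpa using hf_mul 1 1
  let g : (ZMod p)ˣ →* GaussianInt :=
    { toFun a := iPow (RingHom.id _) (f a)
      map_one' := by rw [hf_one, AddChar.map_zero_eq_one]
      map_mul' a b := by rw [hf_mul, AddChar.map_add_eq_mul] }
  exact ⟨MulChar.ofUnitHom g.toHomUnits, fun a => ⟨f a, by simp [g], hf a⟩⟩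

namespace IsQuarticCharacter

variable {ρ : GaussianInt →+* ZMod p} {χ : MulChar (ZMod p) GaussianInt}
  (hχ : IsQuarticCharacter ρ χ) (hp : p % 4 = 1)
include hχ

theorem pow_four : χ ^ 4 = 1 := by
  ext1 a
  obtain ⟨n, hn, -⟩ := hχ a
  rw [MulChar.pow_apply_coe, hn, ← AddChar.map_nsmul_eq_pow, MulChar.one_apply_coe,
    four_nsmul_zmod_four, AddChar.map_zero_eq_one]

theorem inv_eq : χ⁻¹ = χ.ringHomComp (starRingEnd GaussianInt) := by
  symm
  apply eq_inv_of_mul_eq_one_right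
  ext1 a
  obtain ⟨n, hn, -⟩ := hχ a
  rw [MulChar.mul_apply, MulChar.ringHomComp_apply, hn, map_iPow, MulChar.one_apply_coe,
    RingHom.comp_id, ← RingHom.id_comp (starRingEnd GaussianInt), iPow_comp_star,
    ← AddChar.map_add_eq_mul, add_neg_cancel, AddChar.map_zero_eq_one]

include hp

theorem map_apply (a : ZMod p) : ρ (χ a) = a ^ ((p - 1) / 4) := by
  by_cases ha : a = 0
  · have := (Fact.out : p.Prime).two_le
    rw [ha, MulChar.map_zero, map_zero, zero_pow (by omega)]
  · obtain ⟨n, hn, hpow⟩ := hχ (Units.mk0 a ha)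
    rw [Units.val_mk0] at hn hpow
    rw [hn, map_iPow, RingHom.comp_id, hpow]

theorem ringHomComp_mul_self_ne_one {R : Type*} [CommRing R]
    (φ : GaussianInt →+* R) (h2 : (2 : R) ≠ 0) :
    χ.ringHomComp φ * χ.ringHomComp φ ≠ 1 := by
  obtain ⟨a, ha⟩ := FiniteField.exists_nonsquare (F := ZMod p)
    (by rw [ZMod.ringChar_zmod_n]; omega)
  have ha0 : a ≠ 0 := by
    rintro rfl
    exact ha IsSquare.zero
  obtain ⟨n, hn, hpow⟩ := hχ (Units.mk0 a ha0)
  rw [Units.val_mk0] at hn hpow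
  intro h
  have hval := congrArg (fun χ' : MulChar (ZMod p) R => χ' a) h
  simp only [MulChar.mul_apply, MulChar.ringHomComp_apply] at hval
  rw [hn, map_iPow, ← AddChar.map_add_eq_mul, MulChar.one_apply ha0.isUnit,
    ← AddChar.map_zero_eq_one (iPow (φ.comp _)), (iPow_injective _ h2).eq_iff] at hval
  rw [ZMod.euler_criterion p ha0, show p / 2 = (p - 1) / 4 + (p - 1) / 4 by omega, pow_add, hpow,
    ← AddChar.map_add_eq_mul, hval, AddChar.map_zero_eq_one] at ha
  exact ha rfl

theorem ringHomComp_ne_one {R : Type*} [CommRing R] (φ : GaussianInt →+* R) (h2 : (2 : R) ≠ 0) :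
    χ.ringHomComp φ ≠ 1 := fun h =>
  hχ.ringHomComp_mul_self_ne_one hp φ h2 (by rw [h, one_mul])

theorem map_jacobiSum_eq_zero : ρ (jacobiSum χ χ) = 0 := by
  rw [jacobiSum, map_sum]
  simp_rw [map_mul, hχ.map_apply hp]
  have := (Fact.out : p.Prime).two_le
  exact sum_pow_mul_one_sub_pow_zmod (by omega)

theorem norm_jacobiSum : (jacobiSum χ χ).norm = p := by
  have hne := hχ.ringHomComp_ne_one hp GaussianInt.toComplex two_ne_zero
  have h := jacobiSum_mul_jacobiSum_inv
    (by simpa [ringChar.eq_zero, ZMod.ringChar_zmod_n] using (Fact.out : p.Prime).ne_zero.symm)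
    hne hne (hχ.ringHomComp_mul_self_ne_one hp GaussianInt.toComplex two_ne_zero)
  rw [MulChar.ringHomComp_inv, hχ.inv_eq, jacobiSum_ringHomComp, jacobiSum_ringHomComp,
    jacobiSum_ringHomComp, starRingEnd_apply, ← map_mul, ← Zsqrtd.norm_eq_mul_conj, map_intCast,
    ZMod.card] at h
  exact_mod_cast h

theorem even_jacobiSum_im : Even (jacobiSum χ χ).im := by
  have hroot : IsPrimitiveRoot gaussI 4 := by
    refine IsPrimitiveRoot.iff_orderOf.2 (orderOf_eq_prime_pow (p := 2) (n := 1) ?_ gaussI_pow_four)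
    rw [pow_one, gaussI_sq]
    decide
  obtain ⟨z, -, hz⟩ := exists_jacobiSum_eq_neg_one_add (by norm_num) hχ.pow_four hχ.pow_four
    (by rw [ZMod.card]; omega) hroot
  have hsq : (gaussI - 1) ^ 2 = -2 * gaussI := by linear_combination gaussI_sq
  rw [hz, hsq]
  simp [gaussI, Zsqrtd.im_mul]

/-- The Jacobi sum has norm `p` and lies in the kernel of `ρ`, so it is `π` times a unit; the
parity of the imaginary parts leaves only the units `±1`. -/
theorem jacobiSum_sq {π : GaussianInt} (hπ : π.norm = p) (him : Even π.im) (h0 : ρ π = 0) :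
    jacobiSum χ χ ^ 2 = π ^ 2 := by
  have hprime := gaussianPrime_of_norm_eq_natPrime Fact.out hπ
  obtain ⟨κ, hκ⟩ :=
    (map_eq_zero_iff_gaussianPrime_dvd ρ hprime h0 _).1 (hχ.map_jacobiSum_eq_zero hp)
  have hnorm : κ.norm = 1 := by
    have h := hχ.norm_jacobiSum hp
    rw [hκ, Zsqrtd.norm_mul, hπ] at h
    exact (mul_eq_left₀ (by exact_mod_cast (Fact.out : p.Prime).ne_zero)).1 h
  have hre : Odd π.re :=
    odd_re_of_odd_norm (hπ ▸ (Int.odd_coe_nat p).2 (Nat.odd_iff.2 (by omega))) him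
  have hκ_im : Even κ.im := by
    have h := hχ.even_jacobiSum_im hp
    rw [hκ, Zsqrtd.im_mul, Int.even_add, iff_true_right (him.mul_right _), Int.even_mul] at h
    exact h.resolve_left (Int.not_even_iff_odd.2 hre)
  rw [hκ, mul_pow, sq_eq_one_of_norm_eq_one hnorm hκ_im, mul_one]

variable {K : Type*} [Field K] (φ : GaussianInt →+* K) (h2 : (2 : K) ≠ 0)

include h2 in
theorem gaussSum_pow_four {ψ : AddChar (ZMod p) K} (hψ : ψ.IsPrimitive) {π : GaussianInt}
    (hπ : π.norm = p) (him : Even π.im) (h0 : ρ π = 0) :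
    gaussSum (χ.ringHomComp φ) ψ ^ 4 = φ (star π) * φ π ^ 3 := by
  have hne := hχ.ringHomComp_mul_self_ne_one hp φ h2
  have hquad : (χ.ringHomComp φ * χ.ringHomComp φ).IsQuadratic := by
    rw [MulChar.isQuadratic_iff_sq_eq_one, ← sq, ← pow_mul, MulChar.ringHomComp_pow, hχ.pow_four,
      MulChar.ringHomComp_one]
  have hsq := gaussSum_sq hne hquad hψ
  rw [MulChar.mul_apply, ← map_mul, neg_one_mul, neg_neg, MulChar.map_one, one_mul,
    ZMod.card] at hsq
  have hnorm : φ π * φ (star π) = p := by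
    rw [← map_mul, ← Zsqrtd.norm_eq_mul_conj, hπ, map_intCast, Int.cast_natCast]
  have hmul := jacobiSum_mul_nontrivial hne ψ
  rw [jacobiSum_ringHomComp] at hmul
  calc gaussSum (χ.ringHomComp φ) ψ ^ 4
      = (gaussSum (χ.ringHomComp φ) ψ * gaussSum (χ.ringHomComp φ) ψ) ^ 2 := by ring
    _ = p * φ (jacobiSum χ χ ^ 2) := by rw [← hmul, mul_pow, hsq, map_pow]
    _ = φ (star π) * φ π ^ 3 := by rw [hχ.jacobiSum_sq hp hπ him h0, ← hnorm, map_pow]; ring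

end IsQuarticCharacter

end QuarticCharacter

section GaussSumFrobenius

variable {p : ℕ} [Fact p.Prime] {K : Type*} [Field K] {l : ℕ} [Fact l.Prime] [CharP K l]
  {χ : MulChar (ZMod p) K} (hχ : χ ^ 4 = 1) (ψ : AddChar (ZMod p) K)
include hχ

theorem gaussSum_pow_of_mod_four_eq_one (h4 : l % 4 = 1) (hlp : (l : ZMod p) ≠ 0) :
    gaussSum χ ψ ^ l = χ⁻¹ l * gaussSum χ ψ := by
  obtain ⟨u, hu⟩ := hlp.isUnit
  rw [gaussSum_frob, AddChar.pow_mulShift, pow_eq_pow_mod l hχ, h4, pow_one, ← hu,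
    gaussSum_mulShift_eq]

theorem gaussSum_pow_succ_of_mod_four_eq_three (h4 : l % 4 = 3) (hlp : (l : ZMod p) ≠ 0)
    (h1 : χ ≠ 1) {ψ : AddChar (ZMod p) K} (hψ : ψ.IsPrimitive) :
    gaussSum χ ψ ^ (l + 1) = χ (-l) * p := by
  obtain ⟨u, hu⟩ := hlp.isUnit
  have hinv : χ ^ 3 = χ⁻¹ := eq_inv_of_mul_eq_one_left (by rw [← pow_succ, hχ])
  calc gaussSum χ ψ ^ (l + 1)
      = χ l * gaussSum χ⁻¹ ψ * gaussSum χ ψ := by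
        rw [pow_succ, gaussSum_frob, AddChar.pow_mulShift, pow_eq_pow_mod l hχ, h4, hinv, ← hu,
          gaussSum_mulShift_eq, inv_inv]
    _ = χ l * χ⁻¹ (-1) * (gaussSum χ ψ * gaussSum χ⁻¹ ψ⁻¹) := by
        rw [← mul_gaussSum_inv_eq_gaussSum χ⁻¹]
        ring
    _ = χ (-l) * p := by
        rw [gaussSum_mul_gaussSum_eq_card h1 hψ, ZMod.card, MulChar.inv_apply', inv_neg_one,
          ← map_mul, mul_neg_one]

end GaussSumFrobenius

section PrimeReciprocity

variable {p l : ℕ} [hp : Fact p.Prime] [hl : Fact l.Prime]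

theorem exists_isPrimitive_addChar_zmod (hlp : l ≠ p) :
    ∃ ψ : AddChar (ZMod p) (AlgebraicClosure (ZMod l)), ψ.IsPrimitive := by
  have : NeZero (p : ZMod l) := ⟨natCast_ne_zero_of_prime_ne hl.out hp.out hlp⟩
  obtain ⟨ζ, hζ⟩ := HasEnoughRootsOfUnity.exists_primitiveRoot (AlgebraicClosure (ZMod l)) p
  exact ⟨_, AddChar.zmodChar_primitive_of_primitive_root p hζ⟩

namespace IsQuarticCharacter

variable {ρ : GaussianInt →+* ZMod p} {χ : MulChar (ZMod p) GaussianInt}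
  (hχ : IsQuarticCharacter ρ χ) (hp4 : p % 4 = 1) {K : Type*} [Field K] [CharP K l]
  (φ : GaussianInt →+* K) {ψ : AddChar (ZMod p) K} (hψ : ψ.IsPrimitive) {π : GaussianInt}
  (hπ : π.norm = p) (him : Even π.im) (h0 : ρ π = 0) (hlp : l ≠ p) {n : ZMod 4}
include hχ

theorem ringHomComp_pow_four : χ.ringHomComp φ ^ 4 = 1 := by
  rw [MulChar.ringHomComp_pow, hχ.pow_four, MulChar.ringHomComp_one]

include hp4 hψ hπ him h0 hlp

theorem div_star_pow_of_mod_four_eq_one (h4 : l % 4 = 1) (hφ : φ π ≠ 0) (hφ' : φ (star π) ≠ 0)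
    (hn : χ l = iPow (RingHom.id _) n) : (φ π / φ (star π)) ^ ((l - 1) / 4) = iPow φ n := by
  have h2 := two_ne_zero_of_charP_odd (K := K) ((Int.odd_coe_nat l).2 (Nat.odd_iff.2 (by omega)))
  have hlp0 : (l : ZMod p) ≠ 0 := natCast_ne_zero_of_prime_ne hp.out hl.out hlp.symm
  have hi := ((iPow φ).val_isUnit n).ne_zero
  have hg4 := hχ.gaussSum_pow_four hp4 φ h2 hψ hπ him h0
  have hg0 : gaussSum (χ.ringHomComp φ) ψ ≠ 0 :=
    ne_zero_pow four_ne_zero (hg4 ▸ mul_ne_zero hφ' (pow_ne_zero 3 hφ))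
  have hfrob := gaussSum_pow_of_mod_four_eq_one (hχ.ringHomComp_pow_four φ) ψ h4 hlp0
  have hπl := map_pow_char_of_mod_four_eq_one φ l h4 π
  rw [MulChar.inv_apply_eq_inv', MulChar.ringHomComp_apply, hn, map_iPow, RingHom.comp_id] at hfrob
  obtain ⟨f, rfl⟩ : ∃ f, l = 4 * f + 1 := ⟨l / 4, by omega⟩
  rw [pow_succ, mul_left_inj' hg0, pow_mul, hg4] at hfrob
  rw [pow_succ, mul_eq_right₀ hφ] at hπl
  rw [Nat.add_sub_cancel, Nat.mul_div_cancel_left f (by norm_num), div_pow,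
    div_eq_iff (pow_ne_zero _ hφ')]
  calc φ π ^ f
      = iPow φ n * (φ (star π) * φ π ^ 3) ^ f * φ π ^ f := by
        rw [hfrob, mul_inv_cancel₀ hi, one_mul]
    _ = iPow φ n * φ (star π) ^ f * φ π ^ (4 * f) := by ring
    _ = iPow φ n * φ (star π) ^ f := by rw [hπl, mul_one]

theorem star_div_pow_of_mod_four_eq_three (h4 : l % 4 = 3) (hφ : φ π ≠ 0)
    (hn : χ (-l) = iPow (RingHom.id _) n) : (φ (star π) / φ π) ^ ((l + 1) / 4) = iPow φ n := by
  have h2 := two_ne_zero_of_charP_odd (K := K) ((Int.odd_coe_nat l).2 (Nat.odd_iff.2 (by omega)))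
  have hlp0 : (l : ZMod p) ≠ 0 := natCast_ne_zero_of_prime_ne hp.out hl.out hlp.symm
  have hg4 := hχ.gaussSum_pow_four hp4 φ h2 hψ hπ him h0
  have hfrob := gaussSum_pow_succ_of_mod_four_eq_three (hχ.ringHomComp_pow_four φ) h4 hlp0
    (hχ.ringHomComp_ne_one hp4 φ h2) hψ
  have hπl : φ π ^ (l + 1) = p := by
    rw [pow_succ, map_pow_char_of_mod_four_eq_three φ l h4, ← map_mul, mul_comm,
      ← Zsqrtd.norm_eq_mul_conj, hπ, map_intCast, Int.cast_natCast]
  rw [MulChar.ringHomComp_apply, hn, map_iPow, RingHom.comp_id, ← hπl] at hfrob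
  obtain ⟨f, hf⟩ : ∃ f, l + 1 = 4 * f := ⟨(l + 1) / 4, by omega⟩
  rw [hf, pow_mul, hg4] at hfrob
  rw [hf, Nat.mul_div_cancel_left f (by norm_num), div_pow, div_eq_iff (pow_ne_zero _ hφ)]
  apply mul_right_cancel₀ (pow_ne_zero (3 * f) hφ)
  calc φ (star π) ^ f * φ π ^ (3 * f) = (φ (star π) * φ π ^ 3) ^ f := by ring
    _ = iPow φ n * φ π ^ f * φ π ^ (3 * f) := by rw [hfrob]; ring

theorem div_star_zpow_primaryQuarter (hlo : Odd (l : ℤ)) (hφ : φ π ≠ 0) (hφ' : φ (star π) ≠ 0)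
    (hn : χ (primary l : ℤ) = iPow (RingHom.id _) n) :
    (φ π / φ (star π)) ^ primaryQuarter l = iPow φ n := by
  obtain h4 | h4 : l % 4 = 1 ∨ l % 4 = 3 := by grind
  · rw [primary_of_emod_four_eq_one (by omega), Int.cast_natCast] at hn
    rw [← hχ.div_star_pow_of_mod_four_eq_one hp4 φ hψ hπ him h0 hlp h4 hφ hφ' hn, primaryQuarter,
      primary_of_emod_four_eq_one (by omega), ← zpow_natCast]
    congr 1
    omega
  · rw [primary_of_emod_four_eq_three (by omega), Int.cast_neg, Int.cast_natCast] at hn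
    rw [← hχ.star_div_pow_of_mod_four_eq_three hp4 φ hψ hπ him h0 hlp h4 hφ hn, primaryQuarter,
      primary_of_emod_four_eq_three (by omega), ← inv_div, inv_zpow', ← zpow_natCast]
    congr 1
    omega

end IsQuarticCharacter

theorem exists_ringHom_zmod_eq_zero (hp4 : p % 4 = 1) {π : GaussianInt} (hπ : π.norm = p) :
    ∃ ρ : GaussianInt →+* ZMod p, ρ π = 0 := by
  obtain ⟨j, hj⟩ := ZMod.exists_sq_eq_neg_one_iff.2 (show p % 4 ≠ 3 by omega)
  let ρ : GaussianInt →+* ZMod p := Zsqrtd.lift ⟨j, by rw [← hj]; norm_num⟩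
  have hmul : ρ π * ρ (star π) = 0 := by
    rw [← map_mul, ← Zsqrtd.norm_eq_mul_conj, hπ, map_intCast, Int.cast_natCast, CharP.cast_eq_zero]
  rcases mul_eq_zero.1 hmul with h | h
  · exact ⟨ρ, h⟩
  · exact ⟨ρ.comp (starRingEnd GaussianInt), h⟩

theorem quarticJacobiSymbol_natPrime_reciprocity (hlo : Odd (l : ℤ)) (hlp : l ≠ p)
    (hp4 : p % 4 = 1) {π : GaussianInt} (hπ : π.norm = p) (him : Even π.im) :
    quarticJacobiSymbol (primary l) π = quarticJacobiSymbol π l := by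
  have hprime := gaussianPrime_of_norm_eq_natPrime hp.out hπ
  have ho : Odd π.norm := hπ ▸ (Int.odd_coe_nat p).2 (Nat.odd_iff.2 (by omega))
  obtain ⟨φ⟩ := nonempty_ringHom_algebraicClosure l
  obtain ⟨ψ, hψ⟩ := exists_isPrimitive_addChar_zmod hlp
  obtain ⟨ρ, h0⟩ := exists_ringHom_zmod_eq_zero hp4 hπ
  obtain ⟨χ, hχ⟩ := exists_isQuarticCharacter ρ hp4
  have hcop : IsCoprime ((p : ℤ) : GaussianInt) (l : ℤ) :=
    (Nat.isCoprime_iff_coprime.2 ((Nat.coprime_primes hp.out hl.out).2 hlp.symm)).intCast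
  rw [← hπ, Zsqrtd.norm_eq_mul_conj, IsCoprime.mul_left_iff, Int.cast_natCast] at hcop
  have hl0 : φ l = 0 := by rw [map_natCast, CharP.cast_eq_zero]
  have hl_unit : ((primary l : ℤ) : ZMod p) ≠ 0 := by
    have : (l : ZMod p) ≠ 0 := natCast_ne_zero_of_prime_ne hp.out hl.out hlp.symm
    rcases primary_eq_or_eq_neg hlo with h | h <;> rw [h] <;> simpa
  obtain ⟨n, hn, hpow⟩ := hχ (Units.mk0 _ hl_unit)
  have hd : ¬ π ∣ (primary l : GaussianInt) := by
    rwa [← map_eq_zero_iff_gaussianPrime_dvd ρ hprime h0, map_intCast]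
  have hleft : quarticJacobiSymbol (primary l) π = iPow GaussianInt.toComplex n := by
    rw [quarticJacobiSymbol_gaussianPrime _ hprime, quarticResidueSymbol_eq_iff ρ hprime ho h0 hd,
      hπ, Int.natAbs_natCast, map_intCast]
    exact hpow
  rw [hleft, eq_comm, quarticJacobiSymbol_natPrime_eq_iff φ hlo hcop.1]
  exact hχ.div_star_zpow_primaryQuarter hp4 φ hψ hπ him h0 hlp hlo
    (map_ne_zero_of_isCoprime φ hcop.1 hl0) (map_ne_zero_of_isCoprime φ hcop.2 hl0) hn

end PrimeReciprocity

section EvenImaginaryPart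

variable {α β : GaussianInt}

theorem even_im_of_even_im_mul (hα : Odd α.re) (him : Even α.im) (h : Even (α * β).im) :
    Even β.im := by
  rw [Zsqrtd.im_mul, Int.even_add] at h
  exact (Int.even_mul.1 (h.2 (him.mul_right _))).resolve_left (Int.not_even_iff_odd.2 hα)

theorem exists_isUnit_even_im_mul (hα : Odd α.norm) : ∃ u, IsUnit u ∧ Even (u * α).im := by
  obtain h | h := Int.even_or_odd α.im
  · exact ⟨1, isUnit_one, by rwa [one_mul]⟩
  · refine ⟨gaussI, isUnit_gaussI, ?_⟩
    rw [Zsqrtd.norm_def, Int.odd_sub, Int.odd_mul, Int.even_mul, Int.even_mul] at hα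
    have hre : Even α.re := by grind
    simpa [gaussI] using hre

theorem eq_one_or_eq_neg_one_of_isUnit {u : GaussianInt} (hu : IsUnit u) (him : Even u.im) :
    u = 1 ∨ u = -1 :=
  sq_eq_one_iff.1 (sq_eq_one_of_norm_eq_one
    ((Zsqrtd.norm_eq_one_iff' (by norm_num) u).2 hu) him)

theorem quarticJacobiSymbol_one_left (hβ : Odd β.norm) : quarticJacobiSymbol 1 β = 1 :=
  mul_left_cancel₀ (quarticJacobiSymbol_ne_zero hβ isCoprime_one_left)
    (by rw [← quarticJacobiSymbol_mul_left hβ, mul_one, mul_one])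

end EvenImaginaryPart

section Reciprocity

variable {m : ℤ}

theorem isCoprime_primary_iff {α : GaussianInt} (hm : Odd m) :
    IsCoprime (primary m : GaussianInt) α ↔ IsCoprime (m : GaussianInt) α := by
  obtain h | h := primary_eq_or_eq_neg hm <;> rw [h]
  rw [Int.cast_neg, IsCoprime.neg_left_iff]

theorem isCoprime_of_isCoprime_intCast {a b : ℤ} (h : IsCoprime (a : GaussianInt) b) :
    IsCoprime a b := by
  obtain ⟨x, y, hxy⟩ := h
  exact ⟨x.re, y.re, by simpa using congrArg Zsqrtd.re hxy⟩

theorem quarticJacobiSymbol_intCast_reciprocity (hm : Odd m) {a : ℤ} (ha : Odd a) :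
    quarticJacobiSymbol (primary m) a = quarticJacobiSymbol (a : GaussianInt) m := by
  by_cases h : IsCoprime (m : GaussianInt) a
  · rw [quarticJacobiSymbol_intCast_intCast ha (isCoprime_of_isCoprime_intCast
        ((isCoprime_primary_iff hm).2 h)), quarticJacobiSymbol_intCast_intCast hm
        (isCoprime_of_isCoprime_intCast h).symm]
  · rw [quarticJacobiSymbol_eq_zero (odd_norm_intCast ha) fun h' =>
        h ((isCoprime_primary_iff hm).1 h'), quarticJacobiSymbol_eq_zero (odd_norm_intCast hm)
        fun h' => h h'.symm]

theorem exists_eq_intCast_of_associated_intCast {α : GaussianInt} {a : ℤ} (ha : Odd a)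
    (h : Associated (a : GaussianInt) α) (him : Even α.im) : ∃ b : ℤ, α = b := by
  obtain ⟨u, rfl⟩ := h
  have hu : Even (u : GaussianInt).im :=
    even_im_of_even_im_mul (α := a) (by simpa using ha) (by simp) him
  obtain h | h := eq_one_or_eq_neg_one_of_isUnit u.isUnit hu
  · exact ⟨a, by rw [h, mul_one]⟩
  · exact ⟨-a, by rw [h, mul_neg_one, Int.cast_neg]⟩

theorem quarticJacobiSymbol_natPrime_gaussianPrime_reciprocity {l : ℕ} [hl : Fact l.Prime]
    (hlo : Odd (l : ℤ)) {π : GaussianInt} (hπ : Prime π) (ho : Odd π.norm) (him : Even π.im) :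
    quarticJacobiSymbol (primary l) π = quarticJacobiSymbol π ((l : ℤ) : GaussianInt) := by
  obtain ⟨p, hp, hd, ⟨hp4, hnorm⟩ | ⟨hp4, hassoc⟩⟩ := exists_natPrime_of_odd_norm hπ ho
  · have : Fact p.Prime := ⟨hp⟩
    have hnorm : π.norm = p := by rw [← hnorm, GaussianInt.abs_natCast_norm]
    rcases eq_or_ne l p with rfl | hlp
    · have hnc : ¬ IsCoprime ((l : ℤ) : GaussianInt) π := fun h =>
        hπ.not_isUnit (h.isUnit_of_dvd' (by simpa using hd) dvd_rfl)
      rw [quarticJacobiSymbol_eq_zero ho fun h => hnc ((isCoprime_primary_iff hlo).1 h),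
        quarticJacobiSymbol_eq_zero (odd_norm_intCast hlo) fun h => hnc h.symm]
    · exact quarticJacobiSymbol_natPrime_reciprocity hlo hlp hp4 hnorm him
  · have hpo : Odd (p : ℤ) := ⟨p / 2, by omega⟩
    obtain ⟨a, rfl⟩ := exists_eq_intCast_of_associated_intCast hpo
      (by simpa using hassoc.symm) him
    rw [Zsqrtd.norm_intCast] at ho
    exact quarticJacobiSymbol_intCast_reciprocity hlo (Int.odd_mul.1 ho).1

theorem quarticJacobiSymbol_gaussianPrime_reciprocity (hm : Odd m) {π : GaussianInt}
    (hπ : Prime π) (ho : Odd π.norm) (him : Even π.im) :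
    quarticJacobiSymbol (primary m) π = quarticJacobiSymbol π m := by
  induction m, hm using odd_induction with
  | one =>
    rw [primary_of_emod_four_eq_one (by norm_num), Int.cast_one, quarticJacobiSymbol_one_left ho,
      quarticJacobiSymbol_isUnit π isUnit_one]
  | neg m hm ih => rw [primary_neg hm, ih, quarticJacobiSymbol_intCast_neg]
  | prime l hl hlo =>
    have : Fact l.Prime := ⟨hl⟩
    exact quarticJacobiSymbol_natPrime_gaussianPrime_reciprocity hlo hπ ho him
  | mul a b ha hb iha ihb =>
    rw [primary_mul, Int.cast_mul, quarticJacobiSymbol_mul_left ho, iha, ihb,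
      quarticJacobiSymbol_intCast_mul_right π ha hb]

theorem quarticJacobiSymbol_unit_mul_reciprocity (hm : Odd m) (α : GaussianInt) :
    ∀ w : GaussianInt, IsUnit w → Odd (w * α).norm → Even (w * α).im →
      quarticJacobiSymbol (primary m) (w * α) = quarticJacobiSymbol (w * α) m := by
  induction α using UniqueFactorizationMonoid.induction_on_prime with
  | h₁ =>
    intro w _ ho
    simp at ho
  | h₂ u hu =>
    intro w hw ho him
    obtain ⟨a, ha⟩ : ∃ a : ℤ, w * u = a := by
      obtain h | h := eq_one_or_eq_neg_one_of_isUnit (hw.mul hu) him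
      · exact ⟨1, by simpa using h⟩
      · exact ⟨-1, by simpa using h⟩
    rw [ha] at ho ⊢
    rw [Zsqrtd.norm_intCast] at ho
    exact quarticJacobiSymbol_intCast_reciprocity hm (Int.odd_mul.1 ho).1
  | h₃ β π _ hπ ih =>
    intro w hw ho him
    have hoπ : Odd π.norm := odd_norm_of_dvd (Dvd.intro _ (mul_left_comm π w β)) ho
    obtain ⟨u, hu, hev⟩ := exists_isUnit_even_im_mul hoπ
    obtain ⟨v, hv⟩ := hu.exists_right_inv
    have hsplit : w * (π * β) = (u * π) * ((w * v) * β) := by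
      linear_combination (-w * π * β) * hv
    rw [hsplit] at ho him ⊢
    obtain ⟨ho₁, ho₂⟩ := Int.odd_mul.1 (Zsqrtd.norm_mul _ _ ▸ ho)
    rw [quarticJacobiSymbol_mul_right _ (ne_zero_of_odd_norm ho₁) (ne_zero_of_odd_norm ho₂),
      quarticJacobiSymbol_mul_left (odd_norm_intCast hm),
      quarticJacobiSymbol_gaussianPrime_reciprocity hm
        ((associated_unit_mul_left π u hu).symm.prime hπ) ho₁ hev,
      ih (w * v) (hw.mul (.of_mul_eq_one_right u hv)) ho₂
        (even_im_of_even_im_mul (odd_re_of_odd_norm ho₁ hev) hev him)]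

theorem quarticJacobiSymbol_reciprocity (hm : Odd m) {α : GaussianInt} (ho : Odd α.norm)
    (him : Even α.im) : quarticJacobiSymbol (primary m) α = quarticJacobiSymbol α m := by
  simpa using quarticJacobiSymbol_unit_mul_reciprocity hm α 1 isUnit_one (by simpa) (by simpa)

end Reciprocity

/-! ### Supplementary laws for odd real part and even imaginary part -/

section SupplementaryLaws

theorem quarticJacobiSymbol_gaussI_left {α : GaussianInt} (hα : Odd α.norm) :
    quarticJacobiSymbol gaussI α = iPow GaussianInt.toComplex ((α.norm - 1) / 4 : ℤ) := by
  induction α using UniqueFactorizationMonoid.induction_on_prime with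
  | h₁ => simp at hα
  | h₂ u hu =>
    rw [quarticJacobiSymbol_isUnit _ hu, (Zsqrtd.norm_eq_one_iff' (by norm_num) u).2 hu]
    simp
  | h₃ β π _ hπ ih =>
    have hoπ : Odd π.norm := odd_norm_of_dvd (dvd_mul_right _ _) hα
    have hoβ : Odd β.norm := odd_norm_of_dvd (dvd_mul_left _ _) hα
    obtain ⟨K, _, φ, h0⟩ := exists_field_ringHom_eq_zero hπ
    obtain ⟨a, ha⟩ : ∃ a, π.norm = 4 * a + 1 := ⟨π.norm / 4, by have := norm_emod_four hoπ; omega⟩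
    obtain ⟨b, hb⟩ : ∃ b, β.norm = 4 * b + 1 := ⟨β.norm / 4, by have := norm_emod_four hoβ; omega⟩
    have hi : ¬ π ∣ gaussI := fun h => hπ.not_isUnit (isUnit_of_dvd_unit h isUnit_gaussI)
    have hπi : quarticResidueSymbol gaussI π = iPow GaussianInt.toComplex (a : ℤ) := by
      have hexp : ((π.norm.natAbs - 1) / 4 : ℕ) = a := by
        have := GaussianInt.abs_natCast_norm π
        omega
      rw [quarticResidueSymbol_eq_iff φ hπ hoπ h0 hi, ← iPow_natCast, ← hexp, Int.cast_natCast]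
    rw [quarticJacobiSymbol_mul_right _ hπ.ne_zero (ne_zero_of_odd_norm hoβ), ih hoβ,
      quarticJacobiSymbol_gaussianPrime _ hπ, hπi, ← AddChar.map_add_eq_mul, Zsqrtd.norm_mul, ha,
      hb, show (4 * a + 1) * (4 * b + 1) - 1 = 4 * (4 * (a * b) + a + b) by ring,
      Int.mul_ediv_cancel_left _ (by norm_num), add_sub_cancel_right,
      Int.mul_ediv_cancel_left _ (by norm_num)]
    push_cast
    rw [four_eq_zero_zmod_four, zero_mul, zero_add]

variable {a : ℤ} (ha : Odd a) (b : ℤ)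
include ha

theorem odd_norm_mk_two_mul : Odd (Zsqrtd.norm (⟨a, 2 * b⟩ : GaussianInt)) := by
  rw [Zsqrtd.norm_def]
  exact (ha.mul ha).sub_even ⟨-(2 * b * b), by ring⟩

theorem quarticJacobiSymbol_gaussI_mk :
    quarticJacobiSymbol gaussI ⟨a, 2 * b⟩ =
      iPow GaussianInt.toComplex (2 * primaryQuarter a + b ^ 2) := by
  have hsq : a * a = (1 + 4 * primaryQuarter a) * (1 + 4 * primaryQuarter a) := by
    rw [← primary_eq ha]
    obtain h | h := primary_eq_or_eq_neg ha <;> rw [h]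
    ring
  rw [quarticJacobiSymbol_gaussI_left (odd_norm_mk_two_mul ha b), Zsqrtd.norm_def, hsq,
    show ∀ t : ℤ, (1 + 4 * t) * (1 + 4 * t) - -1 * (2 * b) * (2 * b) - 1 =
      4 * (2 * t + 4 * t ^ 2 + b ^ 2) from fun t => by ring,
    Int.mul_ediv_cancel_left _ (by norm_num)]
  push_cast
  rw [four_eq_zero_zmod_four, zero_mul, add_zero]

theorem quarticJacobiSymbol_neg_one_mk :
    quarticJacobiSymbol (-1) ⟨a, 2 * b⟩ = iPow GaussianInt.toComplex (2 * b) := by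
  rw [← gaussI_sq, sq, quarticJacobiSymbol_mul_left (odd_norm_mk_two_mul ha b),
    quarticJacobiSymbol_gaussI_mk ha, ← AddChar.map_add_eq_mul]
  congr 1
  generalize (primaryQuarter a : ZMod 4) = t
  generalize (b : ZMod 4) = b
  decide +revert

theorem quarticJacobiSymbol_intCast_mk {m : ℤ} (hm : Odd m) :
    quarticJacobiSymbol m ⟨a, 2 * b⟩ =
      iPow GaussianInt.toComplex ((m - 1) * b) * quarticJacobiSymbol ⟨a, 2 * b⟩ m := by
  have ho := odd_norm_mk_two_mul ha b
  rw [← quarticJacobiSymbol_reciprocity hm ho (even_two_mul b)]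
  obtain h | h : m % 4 = 1 ∨ m % 4 = 3 := by grind
  · have hm4 : (m : ZMod 4) = 1 := by
      exact_mod_cast (ZMod.intCast_eq_intCast_iff m 1 4).2 h
    rw [primary_of_emod_four_eq_one h, hm4, sub_self, zero_mul, AddChar.map_zero_eq_one, one_mul]
  · have hm4 : (m : ZMod 4) = 3 := by
      exact_mod_cast (ZMod.intCast_eq_intCast_iff m 3 4).2 h
    rw [hm4, show (3 - 1 : ZMod 4) = 2 by decide, ← quarticJacobiSymbol_neg_one_mk ha,
      ← quarticJacobiSymbol_mul_left ho, primary_of_emod_four_eq_three h, Int.cast_neg,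
      neg_one_mul, neg_neg]

variable {b} (hab : IsCoprime a (2 * b))
include hab

theorem quarticJacobiSymbol_re_mk :
    quarticJacobiSymbol a ⟨a, 2 * b⟩ =
      iPow GaussianInt.toComplex ((a - 1) * b + 2 * primaryQuarter a) := by
  have hcongr : (a : GaussianInt) ∣ ⟨a, 2 * b⟩ - (2 * b : ℤ) * gaussI := by
    simp only [mk_eq_add_mul_gaussI]
    exact ⟨1, by ring⟩
  rw [quarticJacobiSymbol_intCast_mk ha b ha,
    quarticJacobiSymbol_congr (odd_norm_intCast ha) hcongr,
    quarticJacobiSymbol_mul_left (odd_norm_intCast ha),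
    quarticJacobiSymbol_intCast_intCast ha hab.symm, quarticJacobiSymbol_gaussI_intCast ha, one_mul,
    ← AddChar.map_add_eq_mul]

theorem quarticJacobiSymbol_re_add_im_mk :
    quarticJacobiSymbol (a + 2 * b : ℤ) ⟨a, 2 * b⟩ =
      iPow GaussianInt.toComplex ((a + 2 * b - 1) * b - primaryQuarter (a + 2 * b)) := by
  have hs : Odd (a + 2 * b) := ha.add_even (even_two_mul b)
  have hcop : IsCoprime a (a + 2 * b) := by simpa [add_comm] using hab.add_mul_left_right 1
  have hcongr : ((a + 2 * b : ℤ) : GaussianInt) ∣ ⟨a, 2 * b⟩ - a * (1 - gaussI) := by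
    simp only [mk_eq_add_mul_gaussI]
    exact ⟨gaussI, by push_cast; ring⟩
  rw [quarticJacobiSymbol_intCast_mk ha b hs,
    quarticJacobiSymbol_congr (odd_norm_intCast hs) hcongr,
    quarticJacobiSymbol_mul_left (odd_norm_intCast hs),
    quarticJacobiSymbol_intCast_intCast hs hcop, quarticJacobiSymbol_one_sub_gaussI_intCast hs,
    one_mul, ← AddChar.map_add_eq_mul, sub_eq_add_neg _ (primaryQuarter _ : ZMod 4)]
  push_cast
  rfl

theorem quarticJacobiSymbol_one_add_gaussI_mk :
    quarticJacobiSymbol (1 + gaussI) ⟨a, 2 * b⟩ =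
      iPow GaussianInt.toComplex
        (2 * primaryQuarter a + 2 * b - primaryQuarter (a + 2 * b)) := by
  have ho := odd_norm_mk_two_mul ha b
  have hcongr : (⟨a, 2 * b⟩ : GaussianInt) ∣ a * (1 + gaussI) - (a + 2 * b : ℤ) := by
    refine ⟨gaussI, ?_⟩
    simp only [mk_eq_add_mul_gaussI]
    push_cast
    linear_combination (-2 * b : GaussianInt) * gaussI_sq
  have h := quarticJacobiSymbol_congr ho hcongr
  rw [quarticJacobiSymbol_mul_left ho, quarticJacobiSymbol_re_mk ha hab,
    quarticJacobiSymbol_re_add_im_mk ha hab] at h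
  refine mul_left_cancel₀ (iPow_toComplex_ne_zero _) (h.trans ?_)
  rw [← AddChar.map_add_eq_mul]
  congr 1
  generalize (primaryQuarter a : ZMod 4) = s
  generalize (primaryQuarter (a + 2 * b) : ZMod 4) = t
  generalize (a : ZMod 4) = a
  generalize (b : ZMod 4) = b
  decide +revert

theorem quarticJacobiSymbol_two_mk :
    quarticJacobiSymbol 2 ⟨a, 2 * b⟩ = iPow GaussianInt.toComplex (a * b) := by
  have ho := odd_norm_mk_two_mul ha b
  have htwo : (2 : GaussianInt) = (1 + gaussI) * (1 + gaussI) * (gaussI * (-1)) := by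
    linear_combination (gaussI + 2) * gaussI_sq
  rw [htwo]
  simp only [quarticJacobiSymbol_mul_left ho, quarticJacobiSymbol_one_add_gaussI_mk ha hab,
    quarticJacobiSymbol_gaussI_mk ha, quarticJacobiSymbol_neg_one_mk ha, ← AddChar.map_add_eq_mul]
  congr 1
  have hA := primary_eq ha
  have hS := primary_eq (ha.add_even (even_two_mul b))
  generalize primaryQuarter a = s at *
  generalize primaryQuarter (a + 2 * b) = t at *
  have hcases : a = 1 + 4 * s ∧ b = 2 * (t - s) ∨ a = 1 + 4 * s ∧ b = -1 - 2 * (s + t) ∨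
      a = -1 - 4 * s ∧ b = 1 + 2 * (s + t) ∨ a = -1 - 4 * s ∧ b = 2 * (s - t) := by
    have := primary_eq_or_eq_neg ha
    have := primary_eq_or_eq_neg (ha.add_even (even_two_mul b))
    omega
  obtain ⟨rfl, rfl⟩ | ⟨rfl, rfl⟩ | ⟨rfl, rfl⟩ | ⟨rfl, rfl⟩ := hcases <;> push_cast <;>
    generalize (s : ZMod 4) = s <;> generalize (t : ZMod 4) = t <;> clear * - <;> decide +revert

end SupplementaryLaws

/-! ### The symbol of `x + c + di` -/

theorem quarticJacobiSymbol_intCast_eq_of_four_dvd_im {a d m : ℤ} (ha : Odd a) (hd : 4 ∣ d)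
    (hm : Odd m) :
    quarticJacobiSymbol (m : GaussianInt) ⟨a, d⟩ = quarticJacobiSymbol ⟨a, d⟩ m := by
  obtain ⟨δ, rfl⟩ := hd
  obtain ⟨k, rfl⟩ := hm
  rw [show 4 * δ = 2 * (2 * δ) by ring, quarticJacobiSymbol_intCast_mk ha _ (odd_two_mul_add_one k)]
  push_cast
  rw [show ((2 * k + 1 - 1) * (2 * δ) : ZMod 4) = 4 * (k * δ) by ring,
    four_eq_zero_zmod_four, zero_mul, AddChar.map_zero_eq_one, one_mul]

theorem quarticJacobiSymbol_intCast_mul_left {a m : ℤ} (hm : Odd m) (ham : IsCoprime a m)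
    (α : GaussianInt) : quarticJacobiSymbol (a * α) m = quarticJacobiSymbol α m := by
  rw [quarticJacobiSymbol_mul_left (odd_norm_intCast hm),
    quarticJacobiSymbol_intCast_intCast hm ham, one_mul]

theorem quarticJacobiSymbol_mk_add_sq {c d x n : ℤ} (hn : Odd n) (hcop : IsCoprime (x + c) n)
    (hdvd : n ∣ c ^ 2 + d ^ 2 - x ^ 2) :
    quarticJacobiSymbol ⟨x + c, d⟩ n ^ 2 = quarticJacobiSymbol ⟨c, d⟩ n := by
  have hcop : IsCoprime (2 * (x + c)) n := (Int.isCoprime_two_left.2 hn).mul_left hcop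
  rw [← quarticJacobiSymbol_intCast_mul_left hn hcop ⟨c, d⟩, sq,
    ← quarticJacobiSymbol_mul_left (odd_norm_intCast hn)]
  refine quarticJacobiSymbol_congr (odd_norm_intCast hn) ?_
  obtain ⟨t, ht⟩ := hdvd
  have ht := congrArg (Int.cast (R := GaussianInt)) ht
  refine ⟨-t, ?_⟩
  simp only [mk_eq_add_mul_gaussI]
  push_cast at ht ⊢
  linear_combination -ht + (d : GaussianInt) ^ 2 * gaussI_sq

theorem quarticJacobiSymbol_pow_left {β : GaussianInt} (hβ : Odd β.norm) (α : GaussianInt)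
    (n : ℕ) : quarticJacobiSymbol (α ^ n) β = quarticJacobiSymbol α β ^ n := by
  induction n with
  | zero => rw [pow_zero, pow_zero, quarticJacobiSymbol_one_left hβ]
  | succ n ih => rw [pow_succ, pow_succ, quarticJacobiSymbol_mul_left hβ, ih]

section

variable {c d x g m D h : ℤ} {v : ℕ}

/- With `α = m + 2Di` and `π = c + di` one has `x + π = 2gα`, and taking norms gives
`4 ^ v * h ≡ -2mx` modulo `α`. -/
theorem mk_dvd_of_sq_add_sq (hg : g ≠ 0) (hxc : x + c = 2 * (g * m)) (hd : d = 4 * (g * D))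
    (heq : c ^ 2 + d ^ 2 = x ^ 2 + 2 * (g * (4 ^ v * h))) :
    (⟨m, 2 * D⟩ : GaussianInt) ∣ 2 ^ (2 * v) * h - -1 * (2 * m * x) := by
  have hnorm : 4 ^ v * h = 2 * g * (m ^ 2 + 4 * D ^ 2) - 2 * m * x := by
    refine mul_left_cancel₀ (mul_ne_zero two_ne_zero hg) ?_
    obtain rfl : c = 2 * (g * m) - x := by linear_combination hxc
    rw [hd] at heq
    linear_combination -heq
  have h := congrArg (Int.cast (R := GaussianInt)) hnorm
  refine ⟨2 * g * (m - 2 * D * gaussI), ?_⟩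
  simp only [mk_eq_add_mul_gaussI]
  rw [pow_mul, show (2 ^ 2 : GaussianInt) = 4 by norm_num]
  push_cast at h ⊢
  linear_combination h + 8 * g * D ^ 2 * gaussI_sq

theorem quarticJacobiSymbol_mk_of_sq_add_sq (hx : x % 4 = 1) (hm : Odd m) (hh : Odd h)
    (hmD : IsCoprime m (2 * D)) (hg : g ≠ 0) (hgx : IsCoprime g x)
    (hxc : x + c = 2 * (g * m)) (hd : d = 4 * (g * D))
    (heq : c ^ 2 + d ^ 2 = x ^ 2 + 2 * (g * (4 ^ v * h))) :
    quarticJacobiSymbol ⟨m, 2 * D⟩ h =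
      iPow GaussianInt.toComplex (2 * primaryQuarter m - (2 * v + h) * D) *
        quarticJacobiSymbol ⟨c, d⟩ x := by
  have hxo : Odd x := Int.odd_iff.2 (by omega)
  have ho := odd_norm_mk_two_mul hm D
  have hπ : quarticJacobiSymbol ⟨m, 2 * D⟩ x = quarticJacobiSymbol ⟨c, d⟩ x := by
    rw [← quarticJacobiSymbol_intCast_mul_left hxo ((Int.isCoprime_two_left.2 hxo).mul_left hgx)]
    refine quarticJacobiSymbol_congr (odd_norm_intCast hxo) ⟨1, ?_⟩
    obtain rfl : c = 2 * (g * m) - x := by linear_combination hxc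
    simp only [mk_eq_add_mul_gaussI]
    rw [hd]
    push_cast
    ring
  have hsymb := quarticJacobiSymbol_congr ho (mk_dvd_of_sq_add_sq hg hxc hd heq)
  have hx4 : (x : ZMod 4) = 1 := by exact_mod_cast (ZMod.intCast_eq_intCast_iff x 1 4).2 hx
  simp only [quarticJacobiSymbol_mul_left ho, quarticJacobiSymbol_pow_left ho,
    quarticJacobiSymbol_two_mk hm hmD, quarticJacobiSymbol_re_mk hm hmD,
    quarticJacobiSymbol_neg_one_mk hm, quarticJacobiSymbol_intCast_mk hm D hh,
    quarticJacobiSymbol_intCast_mk hm D hxo, hx4, hπ, ← AddChar.map_nsmul_eq_pow, ← mul_assoc,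
    ← AddChar.map_add_eq_mul] at hsymb
  refine mul_left_cancel₀ (iPow_toComplex_ne_zero _) (hsymb.trans ?_)
  rw [← mul_assoc, ← AddChar.map_add_eq_mul, nsmul_eq_mul]
  congr 2
  push_cast
  linear_combination (D - v * D) * two_mul_intCast_of_odd hm + D * four_eq_zero_zmod_four

end

theorem odd_of_dvd_odd {m n : ℤ} (hn : Odd n) (h : m ∣ n) : Odd m :=
  Int.not_even_iff_odd.1 fun hm => Int.not_even_iff_odd.2 hn (hm.trans_dvd h)

section Coprime

variable {c d x n : ℤ} (hcop : ∀ n, Odd n → n ∣ x + c → IsCoprime n d)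
include hcop

theorem isCoprime_add_of_dvd_sq (hn : Odd n) (hdvd : n ∣ c ^ 2 + d ^ 2 - x ^ 2) :
    IsCoprime (x + c) n := by
  refine isRelPrime_iff_isCoprime.1 fun e he hen => ?_
  refine (hcop e (odd_of_dvd_odd hn hen) he).pow_right (n := 2) |>.isUnit_of_dvd' dvd_rfl ?_
  convert dvd_add (hen.trans hdvd) (he.mul_right (x - c)) using 1
  ring

theorem isCoprime_add_of_dvd (hn : Odd n) (hnd : n ∣ d) : IsCoprime n (x + c) := by
  refine isRelPrime_iff_isCoprime.1 fun e hen he => ?_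
  exact (hcop e (odd_of_dvd_odd hn hen) he).isUnit_of_dvd' dvd_rfl (hen.trans hnd)

end Coprime

section

variable {c d x q y₀ M δ : ℤ} {v : ℕ}

theorem quarticJacobiSymbol_mk_add_mul_sq (hq : Odd q) (hy₀ : Odd y₀)
    (hcop : ∀ n, Odd n → n ∣ x + c → IsCoprime n d)
    (heq : c ^ 2 + d ^ 2 = x ^ 2 + 2 * (4 ^ v * (q * y₀ ^ 2))) :
    quarticJacobiSymbol ⟨x + c, d⟩ ((q * y₀ ^ 2 : ℤ) : GaussianInt) =
      quarticJacobiSymbol ⟨x + c, d⟩ q * quarticJacobiSymbol ⟨c, d⟩ y₀ := by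
  have hdvd : y₀ ∣ c ^ 2 + d ^ 2 - x ^ 2 := ⟨2 * 4 ^ v * q * y₀, by rw [heq]; ring⟩
  rw [quarticJacobiSymbol_intCast_mul_right _ hq hy₀.pow, sq,
    quarticJacobiSymbol_intCast_mul_right _ hy₀ hy₀, ← sq,
    quarticJacobiSymbol_mk_add_sq hy₀ (isCoprime_add_of_dvd_sq hcop hy₀ hdvd) hdvd]

theorem quarticJacobiSymbol_mk_add_of_emod_four_eq_one (hx : x % 4 = 1) (hq : Odd q)
    (hy₀ : Odd y₀) (hM : Odd M) (hcop : ∀ n, Odd n → n ∣ x + c → IsCoprime n d)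
    (hxc : x + c = 2 * M) (hd : d = 4 * δ)
    (heq : c ^ 2 + d ^ 2 = x ^ 2 + 2 * (4 ^ v * (q * y₀ ^ 2))) :
    quarticJacobiSymbol ⟨x + c, d⟩ q * quarticJacobiSymbol ⟨c, d⟩ y₀ =
      iPow GaussianInt.toComplex (2 * primaryQuarter M - (2 * v + q) * δ) *
        quarticJacobiSymbol ⟨c, d⟩ x := by
  have hh : Odd (q * y₀ ^ 2) := hq.mul hy₀.pow
  have hMδ : IsCoprime M (2 * δ) :=
    (hcop M hM ⟨2, by linarith⟩).of_isCoprime_of_dvd_right ⟨2, by linarith⟩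
  have hcore := quarticJacobiSymbol_mk_of_sq_add_sq hx hM hh hMδ one_ne_zero isCoprime_one_left
    (d := d) (D := δ)
    (by rw [hxc, one_mul]) (by rw [hd, one_mul]) (by rw [heq, one_mul])
  have hα : (⟨x + c, d⟩ : GaussianInt) = (2 : ℤ) * ⟨M, 2 * δ⟩ := by
    simp only [mk_eq_add_mul_gaussI]
    rw [hxc, hd]
    push_cast
    ring
  rw [← quarticJacobiSymbol_mk_add_mul_sq hq hy₀ hcop heq, hα,
    quarticJacobiSymbol_intCast_mul_left hh (Int.isCoprime_two_left.2 hh), hcore, Int.cast_mul,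
    Int.cast_pow, intCast_sq_of_odd hy₀, mul_one]

theorem quarticJacobiSymbol_mk_intCast_of_sq_add_sq (hx : Odd x) (hc : Odd c) (hq : Odd q)
    (hy₀ : Odd y₀) (hcd : IsCoprime c d) (hd : d = 4 * δ)
    (heq : c ^ 2 + d ^ 2 = x ^ 2 + 2 * (4 ^ v * (q * y₀ ^ 2))) :
    quarticJacobiSymbol ⟨c, d⟩ ((q * y₀ ^ 2 : ℤ) : GaussianInt) =
      iPow GaussianInt.toComplex (2 * δ) * quarticJacobiSymbol ⟨c, d⟩ x ^ 2 := by
  have h4d : 4 ∣ d := ⟨δ, hd⟩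
  obtain ⟨D, rfl, hD⟩ : ∃ D, d = 2 * D ∧ D = 2 * δ := ⟨2 * δ, by linarith, rfl⟩
  have ho := odd_norm_mk_two_mul hc D
  have hcongr : (⟨c, 2 * D⟩ : GaussianInt) ∣
      (x : GaussianInt) ^ 2 - -1 * (2 ^ (2 * v + 1) * (q * y₀ ^ 2 : ℤ)) := by
    have h := congrArg (Int.cast (R := GaussianInt)) heq
    refine ⟨c - 2 * D * gaussI, ?_⟩
    simp only [mk_eq_add_mul_gaussI]
    rw [pow_succ (2 : GaussianInt), pow_mul (2 : GaussianInt),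
      show (2 ^ 2 : GaussianInt) = 4 by norm_num]
    push_cast at h ⊢
    linear_combination -h + 4 * D ^ 2 * gaussI_sq
  have hsymb := quarticJacobiSymbol_congr ho hcongr
  simp only [quarticJacobiSymbol_mul_left ho, quarticJacobiSymbol_pow_left ho,
    quarticJacobiSymbol_two_mk hc hcd, quarticJacobiSymbol_neg_one_mk hc,
    quarticJacobiSymbol_intCast_eq_of_four_dvd_im hc h4d hx,
    quarticJacobiSymbol_intCast_eq_of_four_dvd_im hc h4d (hq.mul hy₀.pow),
    ← AddChar.map_nsmul_eq_pow, ← mul_assoc, ← AddChar.map_add_eq_mul] at hsymb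
  rw [hsymb, ← mul_assoc, ← AddChar.map_add_eq_mul, nsmul_eq_mul]
  convert (one_mul _).symm using 2
  rw [← AddChar.map_zero_eq_one (iPow GaussianInt.toComplex)]
  congr 1
  have hD4 : (D : ZMod 4) = 2 * δ := by rw [hD]; push_cast; rfl
  push_cast
  rw [hD4]
  linear_combination δ * two_mul_intCast_of_odd hc + (2 + v * c) * δ * four_eq_zero_zmod_four

end

theorem quarticJacobiSymbol_mk_of_dvd_im {a b m : ℤ} (hm : Odd m) (h : IsCoprime a m)
    (hb : m ∣ b) : quarticJacobiSymbol ⟨a, b⟩ m = 1 := by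
  obtain ⟨t, rfl⟩ := hb
  rw [← quarticJacobiSymbol_intCast_intCast hm h]
  refine quarticJacobiSymbol_congr (odd_norm_intCast hm) ⟨t * gaussI, ?_⟩
  simp only [mk_eq_add_mul_gaussI]
  push_cast
  ring

section

variable {c d x g m D h : ℤ} {v : ℕ}

/- With `α = m + 2Di` and `π = c + di` one has `π - x = 2gα` and
`α(x + π) = 4Diπ + 4 ^ v * h`. -/
theorem quarticJacobiSymbol_mk_add_mul_mk (hh : Odd h) (hg : g ≠ 0) (hDh : IsCoprime D h)
    (hcx : c - x = 2 * (g * m)) (hd : d = 4 * (g * D))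
    (heq : c ^ 2 + d ^ 2 = x ^ 2 + 2 * (4 ^ v * (g * h))) :
    quarticJacobiSymbol ⟨x + c, d⟩ h * quarticJacobiSymbol ⟨m, 2 * D⟩ h =
      iPow GaussianInt.toComplex (2 * primaryQuarter h) * quarticJacobiSymbol ⟨c, d⟩ h := by
  have ho := odd_norm_intCast hh
  have h4D : IsCoprime (4 * D) h :=
    ((Int.isCoprime_two_left.2 hh).pow_left (m := 2)).mul_left hDh
  have hnorm : 4 ^ v * h = (x + c) * m + 2 * d * D := by
    refine mul_left_cancel₀ (mul_ne_zero two_ne_zero hg) ?_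
    linear_combination (-1 : ℤ) * heq + (x + c) * hcx + d * hd
  rw [← quarticJacobiSymbol_gaussI_intCast hh, ← quarticJacobiSymbol_mul_left ho,
    ← quarticJacobiSymbol_mul_left ho,
    ← quarticJacobiSymbol_intCast_mul_left hh h4D (gaussI * ⟨c, d⟩)]
  refine quarticJacobiSymbol_congr ho ⟨4 ^ v, ?_⟩
  obtain rfl : c = x + 2 * (g * m) := by linear_combination hcx
  have hnorm := congrArg (Int.cast (R := GaussianInt)) hnorm
  subst hd
  simp only [mk_eq_add_mul_gaussI]
  push_cast at hnorm ⊢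
  linear_combination -hnorm - 8 * g * D ^ 2 * gaussI_sq

theorem quarticJacobiSymbol_mk_add_of_eq_mul (hx : x % 4 = 3) (hm : Odd m) (hg : Odd g) (hh : Odd h)
    (hmD : IsCoprime m (2 * D)) (hcop : ∀ n, Odd n → n ∣ x + c → IsCoprime n d)
    (hcx : c - x = 2 * (g * m)) (hd : d = 4 * (g * D))
    (heq : c ^ 2 + d ^ 2 = x ^ 2 + 2 * (4 ^ v * (g * h)))
    (hX : quarticJacobiSymbol ⟨c, d⟩ x ≠ 0)
    (hπ : quarticJacobiSymbol ⟨c, d⟩ ((g * h : ℤ) : GaussianInt) =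
      iPow GaussianInt.toComplex (2 * (g * D)) * quarticJacobiSymbol ⟨c, d⟩ x ^ 2) :
    quarticJacobiSymbol ⟨x + c, d⟩ ((g * h : ℤ) : GaussianInt) =
      iPow GaussianInt.toComplex
          (2 * primaryQuarter h + 2 * (g * D) - 2 * primaryQuarter m + (2 * v + h) * D) *
        quarticJacobiSymbol ⟨c, d⟩ x := by
  have hgd : g ∣ d := ⟨4 * D, by rw [hd]; ring⟩
  have hg0 : g ≠ 0 := by rintro rfl; simp at hg
  have hgxc : IsCoprime g (x + c) := isCoprime_add_of_dvd hcop hg hgd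
  have hgc : IsCoprime c g := by
    rw [show x + c = 2 * c + g * (-2 * m) by linear_combination -hcx] at hgxc
    exact hgxc.of_add_mul_left_right.of_mul_right_right.symm
  have hgx : IsCoprime g (-x) := by
    rw [show x + c = -x * -2 + g * (2 * m) by linear_combination hcx] at hgxc
    exact hgxc.of_add_mul_left_right.of_mul_right_left
  have hDh : IsCoprime D h := by
    refine isRelPrime_iff_isCoprime.1 fun n hnD hnh => ?_
    have hn : Odd n := odd_of_dvd_odd hh hnh
    have hnxc := isCoprime_add_of_dvd hcop hn (hd ▸ (hnD.mul_left g).mul_left 4)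
    have hnm : IsCoprime n m :=
      (hmD.of_mul_right_right.of_isCoprime_of_dvd_right hnD).symm
    refine (hnxc.mul_right hnm).isUnit_of_dvd' dvd_rfl ?_
    have hnorm : (x + c) * m = 4 ^ v * h - 2 * d * D := by
      refine mul_left_cancel₀ (mul_ne_zero two_ne_zero hg0) ?_
      linear_combination heq - (x + c) * hcx - d * hd
    exact hnorm ▸ dvd_sub (hnh.mul_left _) (hnD.mul_left _)
  have hcore := quarticJacobiSymbol_mk_of_sq_add_sq (c := c) (x := -x) (v := v) (by omega) hm hh
    hmD hg0 hgx (by rw [← hcx]; ring) hd (by rw [heq]; ring)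
  have hprod := quarticJacobiSymbol_mk_add_mul_mk hh hg0 hDh hcx hd heq
  rw [quarticJacobiSymbol_intCast_neg] at hcore
  rw [quarticJacobiSymbol_intCast_mul_right _ hg hh,
    quarticJacobiSymbol_mk_of_dvd_im hg hgc hgd, one_mul] at hπ
  rw [quarticJacobiSymbol_intCast_mul_right _ hg hh,
    quarticJacobiSymbol_mk_of_dvd_im hg hgxc.symm hgd, one_mul]
  refine mul_right_cancel₀ (mul_ne_zero (iPow_toComplex_ne_zero _) hX) ((hcore ▸ hprod).trans ?_)
  rw [hπ, ← mul_assoc, mul_mul_mul_comm, ← AddChar.map_add_eq_mul, ← AddChar.map_add_eq_mul, sq]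
  congr 2
  ring

end

section

variable {c d x q y₀ M δ : ℤ} {v : ℕ}

theorem quarticJacobiSymbol_mk_add_of_emod_four_eq_three (hx : x % 4 = 3) (hc : Odd c) (hq : Odd q)
    (hy₀ : Odd y₀) (hM : Odd M) (hcd : IsCoprime c d)
    (hcop : ∀ n, Odd n → n ∣ x + c → IsCoprime n d) (hcx : c - x = 2 * M) (hd : d = 4 * δ)
    (heq : c ^ 2 + d ^ 2 = x ^ 2 + 2 * (4 ^ v * (q * y₀ ^ 2)))
    (hX : quarticJacobiSymbol ⟨c, d⟩ x ≠ 0) :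
    quarticJacobiSymbol ⟨x + c, d⟩ q * quarticJacobiSymbol ⟨c, d⟩ y₀ =
      iPow GaussianInt.toComplex
          (2 * primaryQuarter q + 2 * δ - 2 * primaryQuarter M + (2 * v + q) * δ) *
        quarticJacobiSymbol ⟨c, d⟩ x := by
  have hxo : Odd x := Int.odd_iff.2 (by omega)
  have hodd : Odd (q * y₀ ^ 2) := hq.mul hy₀.pow
  have hπ := quarticJacobiSymbol_mk_intCast_of_sq_add_sq hxo hc hq hy₀ hcd hd heq
  obtain ⟨m, D, hMm, hδD, hunit⟩ := extract_gcd M δ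
  generalize gcd M δ = g at hMm hδD
  subst hMm hδD
  obtain ⟨hg, hm⟩ := Int.odd_mul.1 hM
  obtain ⟨h, hgh⟩ : g ∣ q * y₀ ^ 2 := by
    have h2g : IsCoprime g (2 ^ (2 * v)) := (Int.isCoprime_two_right.2 hg).pow_right
    refine h2g.dvd_of_dvd_mul_left ⟨m * (x + c) + 2 * d * D, ?_⟩
    refine mul_left_cancel₀ (two_ne_zero (α := ℤ)) ?_
    rw [pow_mul]
    linear_combination -heq + (x + c) * hcx + d * hd
  have hh : Odd h := (Int.odd_mul.1 (hgh ▸ hodd)).2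
  have hmD : IsCoprime m (2 * D) :=
    (Int.isCoprime_two_right.2 hm).mul_right ((gcd_isUnit_iff m D).1 hunit)
  have hq4 : ((q * y₀ ^ 2 : ℤ) : ZMod 4) = (g * h : ℤ) := by rw [hgh]
  have hquarter : (primaryQuarter (q * y₀ ^ 2) : ZMod 4) = primaryQuarter (g * h) := by rw [hgh]
  rw [← quarticJacobiSymbol_mk_add_mul_sq hq hy₀ hcop heq, hgh,
    quarticJacobiSymbol_mk_add_of_eq_mul hx hm hg hh hmD hcop hcx hd (by rw [heq, hgh]) hX
      (by simpa [hgh] using hπ)]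
  congr 2
  rw [sq, primaryQuarter_mul hq (hy₀.mul hy₀), primaryQuarter_mul hy₀ hy₀,
    primaryQuarter_mul hg hh] at hquarter
  rw [primaryQuarter_mul hg hm]
  push_cast [intCast_sq_of_odd hy₀] at hq4 ⊢
  linear_combination -2 * hquarter + primaryQuarter y₀ * four_eq_zero_zmod_four -
    v * D * two_mul_intCast_of_odd hg - g * D * hq4 - h * D * intCast_sq_of_odd hg

theorem two_mul_primaryQuarter {x' c' w : ℤ} (hM : Odd M) (hq : Odd q)
    (hMeq : M = 1 + 2 * (x' + c'))
    (heq : (1 + 4 * c') ^ 2 + (4 * δ) ^ 2 = (1 + 4 * x') ^ 2 + 2 * (q * (2 * w) ^ 2)) :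
    (2 * primaryQuarter M : ZMod 4) = 2 * c' + 2 * δ + (q + 1) * w := by
  have hprod : M * (x' - c') = 2 * δ ^ 2 - q * w ^ 2 := by
    rw [hMeq]
    linarith
  have hprod := congrArg (Int.cast (R := ZMod 4)) hprod
  have hM' := primary_eq hM
  generalize primaryQuarter M = k at *
  have hq2 := two_mul_intCast_of_odd hq
  have hcases : M = 1 + 4 * k ∧ x' = 2 * k - c' ∨ M = -1 - 4 * k ∧ x' = -1 - 2 * k - c' := by
    have := primary_eq_or_eq_neg hM
    omega
  obtain ⟨hM4, rfl⟩ | ⟨hM4, rfl⟩ := hcases <;>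
  · rw [hM4] at hprod
    push_cast [four_eq_zero_zmod_four] at hprod
    generalize (k : ZMod 4) = k at *
    generalize (c' : ZMod 4) = c at *
    generalize (δ : ZMod 4) = δ at *
    generalize (q : ZMod 4) = q at *
    generalize (w : ZMod 4) = w at *
    clear * - hq2 hprod
    decide +revert

theorem quarticJacobiSymbol_mk_add {c' w : ℤ} (hx : Odd x) (hc : c = 1 + 4 * c') (hq : Odd q)
    (hy₀ : Odd y₀) (hw : 2 * w = 2 ^ v * y₀) (hcd : IsCoprime c d)
    (hcop : ∀ n, Odd n → n ∣ x + c → IsCoprime n d) (hd : d = 4 * δ)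
    (heq : c ^ 2 + d ^ 2 = x ^ 2 + 2 * q * (2 * w) ^ 2)
    (hX : quarticJacobiSymbol ⟨c, d⟩ x ≠ 0) :
    quarticJacobiSymbol ⟨x + c, d⟩ q * quarticJacobiSymbol ⟨c, d⟩ y₀ =
      iPow GaussianInt.toComplex
          (2 * c' - (2 * v + 1) * δ - 2 * primaryQuarter q - (x + 1) * primaryQuarter q -
            (q + 1) * (δ + w)) *
        quarticJacobiSymbol ⟨c, d⟩ x := by
  have heq₀ : c ^ 2 + d ^ 2 = x ^ 2 + 2 * (4 ^ v * (q * y₀ ^ 2)) := by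
    rw [heq, hw, show (4 : ℤ) = 2 ^ 2 by norm_num, ← pow_mul]
    ring
  have hq2 := two_mul_intCast_of_odd hq
  have hcodd : Odd c := ⟨2 * c', by linarith⟩
  obtain h | h : x % 4 = 1 ∨ x % 4 = 3 := by grind
  · obtain ⟨x', rfl⟩ : ∃ x', x = 1 + 4 * x' := ⟨x / 4, by omega⟩
    have hM : Odd (1 + 2 * (x' + c')) := ⟨x' + c', by ring⟩
    have hM' := two_mul_primaryQuarter (δ := δ) (w := w) hM hq rfl (by rw [← hc, ← hd, heq]; ring)
    rw [quarticJacobiSymbol_mk_add_of_emod_four_eq_one h hq hy₀ hM hcop (by rw [hc]; ring) hd heq₀,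
      hM']
    congr 2
    push_cast
    linear_combination
      (δ + primaryQuarter q + x' * primaryQuarter q + w) * four_eq_zero_zmod_four + w * hq2
  · obtain ⟨x', rfl⟩ : ∃ x', x = -(1 + 4 * x') := ⟨(-x) / 4, by omega⟩
    have hM : Odd (1 + 2 * (x' + c')) := ⟨x' + c', by ring⟩
    have hM' := two_mul_primaryQuarter (δ := δ) (w := w) hM hq rfl (by rw [← hc, ← hd, heq]; ring)
    rw [quarticJacobiSymbol_mk_add_of_emod_four_eq_three h hcodd hq hy₀ hM hcd hcop
      (by rw [hc]; ring) hd heq₀ hX, hM']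
    congr 2
    push_cast
    linear_combination
      (primaryQuarter q - c' - x' * primaryQuarter q + v * δ + δ) * four_eq_zero_zmod_four + δ * hq2

end

section RationalSymbol

theorem quarticJacobiSymbolRat_div_one {a b q : ℤ} (hq : Odd q) (hb : b ≠ 0)
    (hbq : IsCoprime b q) :
    quarticJacobiSymbolRat ((a : ℚ) / b) 1 q = quarticJacobiSymbol ⟨a, b⟩ q := by
  set t : ℚ := (a : ℚ) / b with ht
  obtain ⟨s, hs⟩ : (t.den : ℤ) ∣ b := by
    rw [ht, ← Rat.divInt_eq_div]
    exact Rat.den_dvd a b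
  have hnum : a = s * t.num := by
    have hcross : (t.num : ℚ) / t.den = a / b := t.num_div_den
    rw [div_eq_div_iff (Nat.cast_ne_zero.2 t.den_nz) (Int.cast_ne_zero.2 hb), hs] at hcross
    push_cast at hcross
    have hden : (t.den : ℚ) ≠ 0 := Nat.cast_ne_zero.2 t.den_nz
    have : (a : ℚ) = s * t.num := mul_right_cancel₀ hden (by linear_combination -hcross)
    exact_mod_cast this
  rw [hs] at hbq
  have hden := quarticJacobiSymbol_intCast_intCast hq hbq.of_mul_left_left
  have hmk : (⟨a, b⟩ : GaussianInt) = (s : GaussianInt) * ⟨t.num, t.den⟩ := by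
    rw [Zsqrtd.smul_val, ← hnum, hs, mul_comm s]
  rw [hmk, quarticJacobiSymbol_intCast_mul_left hq hbq.of_mul_left_right]
  rw [Int.cast_natCast] at hden
  simp [quarticJacobiSymbolRat, hden]

theorem quarticJacobiSymbolRat_neg_div_one {d b q : ℤ} (hq : Odd q) (hb : b ≠ 0)
    (hbq : IsCoprime b q) :
    quarticJacobiSymbolRat (-(d : ℚ) / b) 1 q =
      iPow GaussianInt.toComplex (2 * primaryQuarter q) * quarticJacobiSymbol ⟨b, d⟩ q := by
  rw [← Int.cast_neg, quarticJacobiSymbolRat_div_one hq hb hbq,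
    ← quarticJacobiSymbol_gaussI_intCast hq,
    ← quarticJacobiSymbol_mul_left (odd_norm_intCast hq)]
  congr 1
  ext <;> simp [gaussI]

end RationalSymbol

/-! ### Eighth powers modulo `p` -/

section EulerCriterion

theorem map_pow_eq_iPow_of_quarticJacobiSymbol_eq {K : Type*} [Field K] (φ : GaussianInt →+* K)
    {π α : GaussianInt} (hπ : Prime π) (ho : Odd π.norm) (h0 : φ π = 0) {n : ZMod 4}
    (h : quarticJacobiSymbol α π = iPow GaussianInt.toComplex n) :
    φ α ^ ((π.norm.natAbs - 1) / 4) = iPow φ n := by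
  rw [quarticJacobiSymbol_gaussianPrime α hπ] at h
  refine (quarticResidueSymbol_eq_iff φ hπ ho h0 (fun hdvd => ?_) n).1 h
  exact iPow_toComplex_ne_zero n (by rw [← h, quarticResidueSymbol, if_pos hdvd])

theorem iPow_two_mul_intCast {K : Type*} [Field K] (φ : GaussianInt →+* K) (n : ℤ) :
    iPow φ (2 * n) = (-1) ^ n := by
  rw [show (2 * n : ZMod 4) = n • 2 by rw [zsmul_eq_mul, mul_comm], AddChar.map_zsmul_eq_zpow,
    iPow_two]

end EulerCriterion

section QuadraticForm

variable {p : ℕ} {c d q x y n : ℤ}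

theorem isCoprime_of_natPrime_eq_sq_add_mul_sq (hp : p.Prime) (h : (p : ℤ) = x ^ 2 + n * y ^ 2) :
    IsCoprime x y := by
  rw [← gcd_isUnit_iff]
  refine (Nat.prime_iff_prime_int.1 hp).irreducible.squarefree _ ?_
  rw [h, ← sq]
  exact dvd_add (pow_dvd_pow_of_dvd (gcd_dvd_left x y) 2)
    (dvd_mul_of_dvd_right (pow_dvd_pow_of_dvd (gcd_dvd_right x y) 2) n)

theorem not_dvd_left_of_natPrime_eq_sq_add_mul_sq (hp : p.Prime) (hpn : ¬ (p : ℤ) ∣ n)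
    (h : (p : ℤ) = x ^ 2 + n * y ^ 2) : ¬ (p : ℤ) ∣ x := by
  intro hx
  have hpp := Nat.prime_iff_prime_int.1 hp
  have hy : (p : ℤ) ∣ n * y ^ 2 := by
    rw [← dvd_add_right (dvd_pow hx two_ne_zero), ← h]
  have hy : (p : ℤ) ∣ y := hpp.dvd_of_dvd_pow ((hpp.dvd_or_dvd hy).resolve_left hpn)
  exact hpp.not_isUnit ((isCoprime_of_natPrime_eq_sq_add_mul_sq hp h).isUnit_of_dvd' hx hy)

theorem not_dvd_right_of_natPrime_eq_sq_add_mul_sq (hp : p.Prime)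
    (h : (p : ℤ) = x ^ 2 + n * y ^ 2) : ¬ (p : ℤ) ∣ y := by
  intro hy
  have hpp := Nat.prime_iff_prime_int.1 hp
  have hx : (p : ℤ) ∣ x ^ 2 := by
    rw [← dvd_add_left (dvd_mul_of_dvd_right (dvd_pow hy two_ne_zero) n), ← h]
  have hx : (p : ℤ) ∣ x := hpp.dvd_of_dvd_pow hx
  exact hpp.not_isUnit ((isCoprime_of_natPrime_eq_sq_add_mul_sq hp h).isUnit_of_dvd' hx hy)

theorem ne_zero_of_natPrime_eq_sq_add_mul_sq (hp : p.Prime) (h : (p : ℤ) = x ^ 2 + n * y ^ 2) :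
    y ≠ 0 := by
  rintro rfl
  exact not_dvd_right_of_natPrime_eq_sq_add_mul_sq hp h (dvd_zero _)

theorem exists_eq_two_pow_mul_odd_int (hn : n ≠ 0) : ∃ (k : ℕ) (m : ℤ), Odd m ∧ n = 2 ^ k * m := by
  have hfin : FiniteMultiplicity 2 n := Int.finiteMultiplicity_iff.2 ⟨by norm_num, hn⟩
  obtain ⟨m, hm, h⟩ := hfin.exists_eq_pow_mul_and_not_dvd
  exact ⟨_, m, Int.not_even_iff_odd.1 fun hm' => h hm'.two_dvd, hm⟩

theorem sq_ne_two_mul_odd_mul_sq (hq : Odd q) (hy : y ≠ 0) : d ^ 2 ≠ 2 * q * y ^ 2 := by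
  intro h
  obtain ⟨v, y₀, hy₀, rfl⟩ := exists_eq_two_pow_mul_odd_int hy
  obtain ⟨e, rfl⟩ : 2 ^ v ∣ d :=
    (Int.pow_dvd_pow_iff two_ne_zero).1 ⟨2 * q * y₀ ^ 2, by rw [h]; ring⟩
  have he : e ^ 2 = 2 * (q * y₀ ^ 2) :=
    mul_left_cancel₀ (pow_ne_zero 2 (pow_ne_zero v two_ne_zero)) (by linear_combination h)
  obtain ⟨f, rfl⟩ : Even e := (Int.even_pow' two_ne_zero).1 (he ▸ even_two_mul _)
  have hodd : Odd (q * y₀ ^ 2) := hq.mul hy₀.pow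
  rw [show q * y₀ ^ 2 = 2 * f ^ 2 by linarith] at hodd
  exact Int.not_odd_iff_even.2 (even_two_mul _) hodd

theorem parity_of_sq_add_sq_eq (hc : c % 4 = 1) (hq : Odd q) (hp : (c ^ 2 + d ^ 2) % 4 = 1)
    (h : c ^ 2 + d ^ 2 = x ^ 2 + 2 * q * y ^ 2) : Odd x ∧ Even y ∧ 4 ∣ d := by
  obtain ⟨s, hs⟩ := Int.eight_dvd_sq_sub_one_of_odd (k := c) (Int.odd_iff.2 (by omega))
  have hx : Odd x := by
    refine Int.not_even_iff_odd.1 ?_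
    rintro ⟨l, rfl⟩
    ring_nf at h
    omega
  obtain ⟨t, ht⟩ := Int.eight_dvd_sq_sub_one_of_odd hx
  have hy : Even y := by
    refine Int.not_odd_iff_even.1 fun hy => ?_
    obtain ⟨l, hl⟩ := hq.mul (hy.pow (n := 2))
    rw [mul_assoc, hl] at h
    omega
  refine ⟨hx, hy, ?_⟩
  obtain ⟨w, rfl⟩ := hy
  have hd : d ^ 2 = 2 * (4 * (t + q * w ^ 2 - s)) := by linear_combination h + ht - hs
  obtain ⟨l, rfl⟩ : Even d := (Int.even_pow' two_ne_zero).1 (hd ▸ even_two_mul _)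
  have hl : l ^ 2 = 2 * (t + q * w ^ 2 - s) := by linarith
  obtain ⟨m, rfl⟩ : Even l := (Int.even_pow' two_ne_zero).1 (hl ▸ even_two_mul _)
  exact ⟨m, by ring⟩

end QuadraticForm

section PrimeAboveP

variable {p : ℕ} [Fact p.Prime] {c d : ℤ} {ρ : GaussianInt →+* ZMod p}

theorem map_gaussI_eq_div (hρ : ρ ⟨c, d⟩ = 0) (hc : ¬ (p : ℤ) ∣ c) :
    ρ gaussI = (d : ZMod p) / c := by
  rw [← ZMod.intCast_zmod_eq_zero_iff_dvd] at hc
  have h : (c : ZMod p) + d * ρ gaussI = 0 := by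
    rw [← hρ, mk_eq_add_mul_gaussI, map_add, map_mul, map_intCast, map_intCast]
  rw [eq_div_iff hc]
  linear_combination ρ gaussI * h - d * map_gaussI_sq ρ

theorem isCoprime_intCast_of_norm_eq_natPrime {p : ℕ} (hp : p.Prime) {π : GaussianInt}
    (hπ : π.norm = p) {n : ℤ} (hn : ¬ (p : ℤ) ∣ n) : IsCoprime (n : GaussianInt) π := by
  have h := (((Nat.prime_iff_prime_int.1 hp).coprime_iff_not_dvd).2 hn).intCast (R := GaussianInt)
  rw [← hπ, Zsqrtd.norm_eq_mul_conj] at h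
  exact h.of_mul_left_left.symm

end PrimeAboveP

section EighthPower

variable {p : ℕ} [hp : Fact p.Prime] {c c' d δ : ℤ} {ρ : GaussianInt →+* ZMod p}

theorem map_pow_eighth_eq_iPow (hp8 : p % 8 = 1) (hpcd : (p : ℤ) = c ^ 2 + d ^ 2)
    (hρ : ρ ⟨c, d⟩ = 0) {α : GaussianInt} {n : ZMod 4}
    (h : quarticJacobiSymbol α ⟨c, d⟩ = iPow GaussianInt.toComplex n) :
    (ρ α ^ 2) ^ ((p - 1) / 8) = iPow ρ n := by
  have hn : (⟨c, d⟩ : GaussianInt).norm = p := by rw [Zsqrtd.norm_def, hpcd]; ring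
  have ho : Odd (⟨c, d⟩ : GaussianInt).norm := by
    rw [hn, Int.odd_coe_nat, Nat.odd_iff]
    omega
  rw [← map_pow_eq_iPow_of_quarticJacobiSymbol_eq ρ
    (gaussianPrime_of_norm_eq_natPrime hp.out hn) ho hρ h, hn, Int.natAbs_natCast, ← pow_mul]
  congr 1
  omega

theorem emod_eight_of_eq_sq_add_sq {p : ℕ} (hc : c = 1 + 4 * c') (hd : d = 4 * δ)
    (hpcd : (p : ℤ) = c ^ 2 + d ^ 2) :
    p % 8 = 1 ∧ (((p - 1) / 8 : ℕ) : ZMod 4) = c' + 2 * c' + 2 * δ := by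
  have h : (p : ℤ) = 1 + 8 * (c' + 2 * c' ^ 2 + 2 * δ ^ 2) := by rw [hpcd, hc, hd]; ring
  refine ⟨by omega, ?_⟩
  obtain ⟨n, hn⟩ : ∃ n, n = (p - 1) / 8 := ⟨_, rfl⟩
  have hn' : (n : ℤ) = c' + 2 * c' ^ 2 + 2 * δ ^ 2 := by omega
  rw [← hn, ← Int.cast_natCast, hn']
  push_cast
  generalize (c' : ZMod 4) = c', (δ : ZMod 4) = δ
  decide +revert

theorem two_pow_eighth_eq_iPow (hc : c = 1 + 4 * c') (hd : d = 4 * δ)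
    (hpcd : (p : ℤ) = c ^ 2 + d ^ 2) (hρ : ρ ⟨c, d⟩ = 0) :
    (2 : ZMod p) ^ ((p - 1) / 8) = iPow ρ (2 * c' + δ) := by
  obtain ⟨hp8, hexp⟩ := emod_eight_of_eq_sq_add_sq hc hd hpcd
  have hcodd : Odd c := ⟨2 * c', by linarith⟩
  have hcd : IsCoprime c (2 * (2 * δ)) := by
    rw [show 2 * (2 * δ) = d by linarith]
    exact isCoprime_of_natPrime_eq_sq_add_mul_sq (n := 1) hp.out (by linarith)
  have hsymbol := quarticJacobiSymbol_one_add_gaussI_mk hcodd hcd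
  rw [show 2 * (2 * δ) = d by linarith, show c + d = 1 + 4 * (c' + δ) by linarith, hc,
    primaryQuarter_one_add_four_mul, primaryQuarter_one_add_four_mul, ← hc] at hsymbol
  have htwo : (2 : GaussianInt) = (1 + gaussI) ^ 2 * gaussI ^ 3 := by
    linear_combination (-(gaussI ^ 3 + 2 * gaussI ^ 2 - 2)) * gaussI_sq
  have htwo := congrArg ρ htwo
  rw [map_mul, map_pow, map_pow, map_ofNat] at htwo
  rw [htwo, mul_pow, map_pow_eighth_eq_iPow hp8 hpcd hρ hsymbol, ← pow_mul, ← iPow_natCast,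
    ← AddChar.map_add_eq_mul]
  congr 1
  push_cast [hexp]
  linear_combination (2 * c' + 2 * δ) * four_eq_zero_zmod_four

theorem neg_pow_eighth_eq_iPow {q x y₀ : ℤ} {v : ℕ} (hc : c = 1 + 4 * c') (hd : d = 4 * δ)
    (hpcd : (p : ℤ) = c ^ 2 + d ^ 2) (hpq : (p : ℤ) = x ^ 2 + 2 * q * (2 ^ v * y₀) ^ 2)
    (hρ : ρ ⟨c, d⟩ = 0) {X Y : ZMod 4}
    (hX : quarticJacobiSymbol x ⟨c, d⟩ = iPow GaussianInt.toComplex X)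
    (hY : quarticJacobiSymbol y₀ ⟨c, d⟩ = iPow GaussianInt.toComplex Y) :
    (-(q : ZMod p)) ^ ((p - 1) / 8) = iPow ρ (X - Y - 2 * c' - (2 * v + 1) * δ) := by
  obtain ⟨hp8, -⟩ := emod_eight_of_eq_sq_add_sq hc hd hpcd
  have hX := map_pow_eighth_eq_iPow hp8 hpcd hρ hX
  have hY := map_pow_eighth_eq_iPow hp8 hpcd hρ hY
  have h2 := two_pow_eighth_eq_iPow hc hd hpcd hρ
  rw [map_intCast] at hX hY
  have hx : (x : ZMod p) ^ 2 = -(q : ZMod p) * (2 ^ (2 * v + 1) * (y₀ : ZMod p) ^ 2) := by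
    have h := congrArg (Int.cast (R := ZMod p)) hpq
    push_cast at h
    rw [ZMod.natCast_self] at h
    linear_combination -h
  rw [hx, mul_pow, mul_pow, hY, pow_right_comm, h2, ← AddChar.map_nsmul_eq_pow,
    ← AddChar.map_add_eq_mul] at hX
  rw [← mul_left_inj' ((iPow ρ).val_isUnit _).ne_zero, hX, ← AddChar.map_add_eq_mul]
  congr 1
  rw [nsmul_eq_mul]
  push_cast
  linear_combination -v * c' * four_eq_zero_zmod_four

end EighthPower

theorem neg_pow_eighth_eq_iPow_of_quarticJacobiSymbol {p : ℕ} [hp : Fact p.Prime] {q c d x y : ℤ}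
    (hq : Odd q) (hpq : ¬ (p : ℤ) ∣ q) (hpcd : (p : ℤ) = c ^ 2 + d ^ 2)
    (hpxy : (p : ℤ) = x ^ 2 + 2 * q * y ^ 2) {c' δ w : ℤ} (hx : Odd x) (hc : c = 1 + 4 * c')
    (hd : d = 4 * δ) (hy : y = 2 * w) (hcop : ∀ n, Odd n → n ∣ x + c → IsCoprime n d)
    {ρ : GaussianInt →+* ZMod p} (hρ : ρ ⟨c, d⟩ = 0) {κ : ZMod 4}
    (hκ : iPow GaussianInt.toComplex (2 * primaryQuarter q) * quarticJacobiSymbol ⟨x + c, d⟩ q =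
      iPow GaussianInt.toComplex κ) :
    (-(q : ZMod p)) ^ ((p - 1) / 8) =
      iPow ρ (κ + ((x + 1) * primaryQuarter q + (q + 1) * (δ + w))) := by
  obtain ⟨hp8, -⟩ := emod_eight_of_eq_sq_add_sq hc hd hpcd
  have hcodd : Odd c := ⟨2 * c', by linarith⟩
  have hpq2 : ¬ (p : ℤ) ∣ 2 * q := by
    refine fun h => ((Nat.prime_iff_prime_int.1 hp.out).dvd_or_dvd h).elim (fun h2 => ?_) hpq
    have := Int.le_of_dvd two_pos h2
    have := hp.out.two_le
    omega
  have hn : (⟨c, d⟩ : GaussianInt).norm = p := by rw [Zsqrtd.norm_def, hpcd]; ring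
  have ho : Odd (⟨c, d⟩ : GaussianInt).norm := by
    rw [hn, Int.odd_coe_nat, Nat.odd_iff]
    omega
  obtain ⟨v, y₀, hy₀, hyv⟩ :=
    exists_eq_two_pow_mul_odd_int (ne_zero_of_natPrime_eq_sq_add_mul_sq hp.out hpxy)
  have hpx := not_dvd_left_of_natPrime_eq_sq_add_mul_sq hp.out hpq2 hpxy
  have hpy₀ : ¬ (p : ℤ) ∣ y₀ := fun h =>
    not_dvd_right_of_natPrime_eq_sq_add_mul_sq hp.out hpxy (hyv ▸ h.mul_left _)
  obtain ⟨X, hX⟩ :=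
    exists_quarticJacobiSymbol_eq_iPow ho (isCoprime_intCast_of_norm_eq_natPrime hp.out hn hpx)
  obtain ⟨Y, hY⟩ :=
    exists_quarticJacobiSymbol_eq_iPow ho (isCoprime_intCast_of_norm_eq_natPrime hp.out hn hpy₀)
  rw [neg_pow_eighth_eq_iPow hc hd hpcd (hyv ▸ hpxy) hρ hX hY]
  rw [quarticJacobiSymbol_intCast_eq_of_four_dvd_im hcodd ⟨δ, hd⟩ hx] at hX
  rw [quarticJacobiSymbol_intCast_eq_of_four_dvd_im hcodd ⟨δ, hd⟩ hy₀] at hY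
  have hcd := isCoprime_of_natPrime_eq_sq_add_mul_sq (n := 1) (x := c) (y := d) hp.out
    (by linarith)
  have hrel := quarticJacobiSymbol_mk_add hx hc hq hy₀ (hy ▸ hyv) hcd hcop hd
    (by rw [← hpcd, hpxy, hy]) (hX ▸ iPow_toComplex_ne_zero X)
  have hrel : iPow GaussianInt.toComplex (κ + Y) = iPow GaussianInt.toComplex
      (2 * primaryQuarter q + (2 * c' - (2 * v + 1) * δ - 2 * primaryQuarter q -
        (x + 1) * primaryQuarter q - (q + 1) * (δ + w) + X)) := by
    rw [AddChar.map_add_eq_mul, ← hκ, ← hY, mul_assoc, hrel, hX, ← AddChar.map_add_eq_mul,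
      ← AddChar.map_add_eq_mul]
  have hrel := iPow_toComplex_injective hrel
  congr 1
  linear_combination -hrel - c' * four_eq_zero_zmod_four

section SignExponent

variable {q x : ℤ} (hx : Odd x)
include hx

theorem exponent_of_emod_four_eq_one (hq : q % 4 = 1) (δ w : ℤ) :
    ((x + 1) * primaryQuarter q + (q + 1) * (δ + w) : ZMod 4) =
      2 * ((x + 1) / 2 * ((q - 1) / 4) + δ + w : ℤ) := by
  obtain ⟨l, rfl⟩ := hx
  obtain ⟨s, rfl⟩ : ∃ s, q = 1 + 4 * s := ⟨q / 4, by omega⟩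
  rw [primaryQuarter_one_add_four_mul, show (2 * l + 1 + 1) / 2 = l + 1 by omega,
    show (1 + 4 * s - 1) / 4 = s by omega]
  push_cast
  linear_combination s * (δ + w) * four_eq_zero_zmod_four

theorem exponent_of_emod_four_eq_three (hq : q % 4 = 3) (δ w : ℤ) :
    ((x + 1) * primaryQuarter q + (q + 1) * (δ + w) : ZMod 4) =
      2 * ((x + 1) / 2 * ((q + 1) / 4) : ℤ) := by
  obtain ⟨l, rfl⟩ := hx
  obtain ⟨s, rfl⟩ : ∃ s, q = -(1 + 4 * s) := ⟨-q / 4, by omega⟩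
  rw [primaryQuarter_neg ⟨2 * s, by ring⟩, primaryQuarter_one_add_four_mul,
    show (2 * l + 1 + 1) / 2 = l + 1 by omega, show (-(1 + 4 * s) + 1) / 4 = -s by omega]
  push_cast
  linear_combination (s * (l + 1) - s * (δ + w)) * four_eq_zero_zmod_four

end SignExponent

theorem theorem4p2_general (p : ℕ) [hp : Fact p.Prime] (hp4 : p ≡ 1 [MOD 4])
    (q : ℤ) (hq : Odd q) (hpq : ¬ (p : ℤ) ∣ q)
    (c d x y : ℤ) (hcd : (p : ℤ) = c ^ 2 + d ^ 2) (hxy : (p : ℤ) = x ^ 2 + 2 * q * y ^ 2)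
    (hc : c ≡ 1 [ZMOD 4]) (hcop : ∀ n, Odd n → n ∣ x + c → IsCoprime n d)
    (k : ℤ) (hk : quarticJacobiSymbolRat (-(d : ℚ) / ((x : ℚ) + (c : ℚ))) 1 q = Complex.I ^ k) :
    (q ≡ 1 [ZMOD 4] →
      (-(q : ZMod p)) ^ ((p - 1) / 8) =
        (-1 : ZMod p) ^ ((x + 1) / 2 * ((q - 1) / 4) + d / 4 + y / 2) *
          ((d : ZMod p) / (c : ZMod p)) ^ k) ∧
    (q ≡ 3 [ZMOD 4] →
      (-(q : ZMod p)) ^ ((p - 1) / 8) =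
        (-1 : ZMod p) ^ ((x + 1) / 2 * ((q + 1) / 4)) *
          ((d : ZMod p) / (c : ZMod p)) ^ k) := by
  have hsq : c ^ 2 + d ^ 2 = x ^ 2 + 2 * q * y ^ 2 := hcd ▸ hxy
  obtain ⟨hx, ⟨w, hw⟩, δ, hδ⟩ :=
    parity_of_sq_add_sq_eq hc hq (by rw [← hcd]; exact_mod_cast hp4) hsq
  have hy₀ : y ≠ 0 := ne_zero_of_natPrime_eq_sq_add_mul_sq hp.out hxy
  have hxc : x + c ≠ 0 := fun h => sq_ne_two_mul_odd_mul_sq (d := d) hq hy₀ (by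
    rw [eq_neg_of_add_eq_zero_left h] at hsq
    linear_combination hsq)
  have hxcq : IsCoprime (x + c) q := isCoprime_add_of_dvd_sq hcop hq
    ⟨2 * y ^ 2, by linear_combination hsq⟩
  obtain ⟨ρ, hρ⟩ := exists_ringHom_zmod_eq_zero hp4 (π := ⟨c, d⟩)
    (by rw [Zsqrtd.norm_def, hcd]; ring)
  have hρi : ρ gaussI = (d : ZMod p) / c := map_gaussI_eq_div hρ
    (not_dvd_left_of_natPrime_eq_sq_add_mul_sq (n := 1) (y := d) hp.out
      (Nat.prime_iff_prime_int.1 hp.out).not_dvd_one (by linarith))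
  rw [← Int.cast_add, quarticJacobiSymbolRat_neg_div_one hq hxc hxcq,
    ← iPow_toComplex_intCast] at hk
  have hmain := neg_pow_eighth_eq_iPow_of_quarticJacobiSymbol hq hpq hcd hxy hx
    (show c = 1 + 4 * (c / 4) by have : c % 4 = 1 := hc; omega) hδ (hw.trans (two_mul w).symm)
    hcop hρ hk
  rw [AddChar.map_add_eq_mul, iPow_intCast, hρi, mul_comm] at hmain
  refine ⟨fun hq1 => ?_, fun hq3 => ?_⟩
  · rw [hmain, exponent_of_emod_four_eq_one hx hq1, iPow_two_mul_intCast, hδ, hw, ← two_mul,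
      Int.mul_ediv_cancel_left _ four_ne_zero, Int.mul_ediv_cancel_left _ two_ne_zero]
  · rw [hmain, exponent_of_emod_four_eq_three hx hq3, iPow_two_mul_intCast]

theorem theorem4p2 (p : ℕ) [Fact p.Prime] (hp4 : p ≡ 1 [MOD 4])
    (q : ℤ) (hq : Odd q) (hpq : ¬ (p : ℤ) ∣ q)
    (c d x y : ℤ) (hcd : (p : ℤ) = c ^ 2 + d ^ 2) (hxy : (p : ℤ) = x ^ 2 + 2 * q * y ^ 2)
    (hc : c ≡ 1 [ZMOD 4])
    (r : ℕ) (d₀ : ℤ) (hd : d = 2 ^ r * d₀) (hd₀ : d₀ ≡ 1 [ZMOD 4])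
    (hgcd : Int.gcd d₀ (x + c) = 1)
    (k : ℤ) (hk : quarticJacobiSymbolRat (-(d : ℚ) / ((x : ℚ) + (c : ℚ))) 1 q = Complex.I ^ k) :
    (q ≡ 1 [ZMOD 4] →
      (-(q : ZMod p)) ^ ((p - 1) / 8) =
        (-1 : ZMod p) ^ ((x + 1) / 2 * ((q - 1) / 4) + d / 4 + y / 2) *
          ((d : ZMod p) / (c : ZMod p)) ^ k) ∧
    (q ≡ 3 [ZMOD 4] →
      (-(q : ZMod p)) ^ ((p - 1) / 8) =
        (-1 : ZMod p) ^ ((x + 1) / 2 * ((q + 1) / 4)) *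
          ((d : ZMod p) / (c : ZMod p)) ^ k) :=
  theorem4p2_general p hp4 q hq hpq c d x y hcd hxy hc (fun _ hn hdvd => hd ▸
    (Int.isCoprime_two_right.2 hn).pow_right.mul_right
      ((Int.isCoprime_iff_gcd_eq_one.2 hgcd).symm.of_isCoprime_of_dvd_left hdvd)) k hk
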